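/- For $\alpha\ge 0$ let $\mathrm{H}^\alpha=\mathrm{H}^\alpha(0,1)$ be the space of all $f\in L^2(0,1)$ with $\|f\|_\alpha^2:=\sum_{n\ge1}n^{2\alpha}|\hat f(n)|^2<\infty$, where $\hat f(n)=\sqrt2\int_0^1 f(x)\sin(n\pi x)\,dx$. For a modulus $\mu\in(0,1)$ let $K(\mu)=\int_0^1(1-t^2)^{-1/2}(1-\mu^2t^2)^{-1/2}\,dt$, let $\operatorname{sn}(\cdot,\mu)$ be the Jacobi elliptic sine (the inverse on $[0,K(\mu)]$ of $z\mapsto\int_0^z(1-t^2)^{-1/2}(1-\mu^2t^2)^{-1/2}\,dt$, $z\in[0,1]$, extended to $\mathbb R$ so as to be odd, symmetric about $K(\mu)$ and $4K(\mu)$-periodic), and let $$q=\exp\left[-\pi\,\frac{K\big(\sqrt{1-\mu^2}\big)}{K(\mu)}\right]\in(0,1)$$ be the nome associated to $\mu$. For $n\in\mathbb N=\{1,2,\dots\}$ the functions $$u_n(x,\mu)=2^{3/2}\,n\,\mu\,K(\mu)\operatorname{sn}\big(2K(\mu)nx,\mu\big)$$ are eigenfunctions of the Gross–Pitaevskii problem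 $u''-u^3+\eta u=0$ on $(0,1)$, $u(0)=u(1)=0$, with eigenvalues $\eta=4n^2(1+\mu^2)K(\mu)^2$. For $q\in(0,1)$ put $$s_\alpha(q)=\sum_{l=0}^\infty(2l+1)^\alpha\frac{(1-q)q^l}{1-q^{2l+1}}.$$ **Theorem.** Let $p\neq1$ be an odd positive integer and let $\alpha\ge0$. Then the equation $$s_\alpha(q)=2+\frac{p^\alpha(1-q)q^{\frac{p^2-1}{2}}}{2\,(1-q^{p^2})}$$ has a unique solution $q=r_1(\alpha)$ in $(0,1)$. Let $\{q_n\}_{n\ge1}\subset(0,1)$ be any sequence such that $\sup_n q_n<r_1(\alpha)$ and $q_n=q_{pn}$ for all $n\in\mathbb N$, and let $\mu_n\in(0,1)$ be moduli whose associated nomes are $q_n$. Then the set of eigenfunctions $\{u_n(\cdot,\mu_n)\}_{n\ge1}$ is a basis of $\mathrm{H}^\alpha$ (an unconditional Schauder basis: every $f\in\mathrm{H}^\alpha$ has a unique expansion $f=\sum_n a_nu_n(\cdot,\mu_n)$ with scalars $a_n$, and it converges unconditionally in $\mathrm{H}^\alpha$). -/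

import Mathlib

open MeasureTheory Set
open scoped ENNReal

noncomputable section

/-! ### Sobolev spaces on the unit interval, through sine coefficients -/

/-- Lebesgue measure on the interval `(0, 1)`. -/
abbrev unitMeasure : Measure ℝ := volume.restrict (Ioo (0 : ℝ) 1)

/-- The sine coefficient `√2 ∫₀¹ f(x) sin(nπx) dx`. -/
def sineCoeff {𝕜 : Type*} [RCLike 𝕜] (f : ℝ → 𝕜) (n : ℕ+) : 𝕜 :=
  (Real.sqrt 2) • ∫ x, Real.sin ((n : ℕ) * Real.pi * x) • f x ∂unitMeasure

theorem sineCoeff_congr {𝕜 : Type*} [RCLike 𝕜] {f g : ℝ → 𝕜} (h : f =ᵐ[unitMeasure] g) (n : ℕ+) :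
    sineCoeff f n = sineCoeff g n := by
  unfold sineCoeff
  congr 1
  refine integral_congr_ae ?_
  filter_upwards [h] with x hx
  rw [hx]

theorem integrable_sin_smul {𝕜 : Type*} [RCLike 𝕜] (f : Lp 𝕜 2 unitMeasure) (n : ℕ+) :
    Integrable (fun x => Real.sin ((n : ℕ) * Real.pi * x) • f x) unitMeasure := by
  have hf : Integrable f unitMeasure := (Lp.memLp f).integrable (by norm_num)
  have hc : Continuous fun x : ℝ => Real.sin ((n : ℕ) * Real.pi * x) := by fun_prop
  exact Integrable.bdd_smul (𝕜 := ℝ) hf 1 hc.aestronglyMeasurable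
    (Filter.Eventually.of_forall fun x => by simpa using Real.abs_sin_le_one _)

theorem sineCoeff_add {𝕜 : Type*} [RCLike 𝕜] (f g : Lp 𝕜 2 unitMeasure) (n : ℕ+) :
    sineCoeff (f + g : Lp 𝕜 2 unitMeasure) n = sineCoeff f n + sineCoeff g n := by
  rw [sineCoeff_congr (Lp.coeFn_add f g) n]
  unfold sineCoeff
  rw [← smul_add, ← integral_add (integrable_sin_smul f n) (integrable_sin_smul g n)]
  simp only [Pi.add_apply, smul_add]

theorem sineCoeff_smul {𝕜 : Type*} [RCLike 𝕜] (c : 𝕜) (f : Lp 𝕜 2 unitMeasure) (n : ℕ+) :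
    sineCoeff (c • f : Lp 𝕜 2 unitMeasure) n = c * sineCoeff f n := by
  rw [sineCoeff_congr (Lp.coeFn_smul c f) n]
  unfold sineCoeff
  simp only [Pi.smul_apply, smul_eq_mul]
  rw [mul_smul_comm, ← integral_const_mul]
  simp only [mul_smul_comm]

/-- The sine system is complete in `L²(0, 1)`. -/
theorem ae_zero_of_sineCoeff_eq_zero {𝕜 : Type*} [RCLike 𝕜] {f : ℝ → 𝕜} (hf : MemLp f 2 unitMeasure)
    (h : ∀ n, sineCoeff f n = 0) : f =ᵐ[unitMeasure] 0 := by
  set φ : 𝕜 →L[ℝ] ℂ := RCLike.map 𝕜 ℂ with hφ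
  set f₀ : ℝ → ℂ := (Ioo (0 : ℝ) 1).indicator (fun x => φ (f x)) with hf₀
  have hφf : MemLp (fun x => φ (f x)) 2 unitMeasure := φ.comp_memLp' hf
  have hm : MemLp f₀ 2 volume := (memLp_indicator_iff_restrict measurableSet_Ioo).2 hφf
  have hm' : MemLp (fun x => f₀ (-x)) 2 volume :=
    hm.comp_measurePreserving (Measure.measurePreserving_neg volume)
  have hF : MemLp (fun x => f₀ x - f₀ (-x)) 2 volume := hm.sub hm'
  have hsub01 : Ioo (0 : ℝ) 1 ⊆ Ioc (-1 : ℝ) 1 := fun x hx => ⟨by linarith [hx.1], hx.2.le⟩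
  have hsin : ∀ n : ℤ, ∫ x in (-1 : ℝ)..1, Real.sin (n * Real.pi * x) • f₀ x = 0 := by
    have hpos : ∀ n : ℕ+, ∫ x in (-1 : ℝ)..1, Real.sin ((n : ℕ) * Real.pi * x) • f₀ x = 0 := by
      intro n
      have h1 : (fun x => Real.sin ((n : ℕ) * Real.pi * x) • f₀ x)
          = (Ioo (0 : ℝ) 1).indicator
            (fun x => φ (Real.sin ((n : ℕ) * Real.pi * x) • f x)) := by
        ext x
        by_cases hx : x ∈ Ioo (0 : ℝ) 1
        · rw [indicator_of_mem hx, hf₀, indicator_of_mem hx, map_smul]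
        · rw [indicator_of_notMem hx, hf₀, indicator_of_notMem hx, smul_zero]
      rw [intervalIntegral.integral_of_le (by norm_num), h1, setIntegral_indicator measurableSet_Ioo,
        inter_eq_right.2 hsub01]
      have h2 := h n
      unfold sineCoeff at h2
      rw [smul_eq_zero_iff_right (by positivity)] at h2
      have hi := integrable_sin_smul (hf.toLp f) n
      have hi' : Integrable (fun x => Real.sin ((n : ℕ) * Real.pi * x) • f x) unitMeasure := by
        refine hi.congr ?_
        filter_upwards [hf.coeFn_toLp] with x hx
        rw [hx]
      rw [φ.integral_comp_comm hi', h2, map_zero]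
    intro n
    rcases lt_trichotomy n 0 with hn | hn | hn
    · have h3 := hpos ⟨n.natAbs, by omega⟩
      have h4 : ((n.natAbs : ℕ) : ℝ) = -(n : ℝ) := by
        rw [Nat.cast_natAbs, abs_of_neg hn]; push_cast; ring
      simp only [PNat.mk_coe, h4, neg_mul, Real.sin_neg, neg_smul,
        intervalIntegral.integral_neg, neg_eq_zero] at h3
      exact h3
    · simp [hn]
    · have h3 := hpos ⟨n.natAbs, by omega⟩
      have h4 : ((n.natAbs : ℕ) : ℝ) = (n : ℝ) := by
        rw [Nat.cast_natAbs, abs_of_pos hn]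
      simpa only [PNat.mk_coe, h4] using h3
  have hint : Integrable f₀ (volume.restrict (Ioc (-1 : ℝ) 1)) :=
    (hm.restrict _).integrable (by norm_num)
  have hint' : Integrable (fun x => f₀ (-x)) (volume.restrict (Ioc (-1 : ℝ) 1)) :=
    (hm'.restrict _).integrable (by norm_num)
  have hcoef : ∀ n : ℤ, fourierCoeffOn (by norm_num : (-1 : ℝ) < 1)
      (fun x => f₀ x - f₀ (-x)) n = 0 := by
    intro n
    rw [fourierCoeffOn_eq_integral]
    have he : ∀ x : ℝ, (fourier (-n) (x : AddCircle ((1 : ℝ) - -1)) : ℂ)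
        = Complex.exp (-(n * Real.pi * x : ℝ) * Complex.I) := by
      intro x
      rw [fourier_coe_apply]
      congr 1
      push_cast
      ring
    simp only [he]
    have hc : Continuous fun x : ℝ => Complex.exp (-(n * Real.pi * x : ℝ) * Complex.I) := by
      fun_prop
    have hb : ∀ x : ℝ, ‖Complex.exp (-(n * Real.pi * x : ℝ) * Complex.I)‖ ≤ 1 := by
      intro x
      rw [← Complex.ofReal_neg, Complex.norm_exp_ofReal_mul_I]
    have hb' : ∀ x : ℝ, ‖Complex.exp ((n * Real.pi * x : ℝ) * Complex.I)‖ ≤ 1 := by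
      intro x
      rw [Complex.norm_exp_ofReal_mul_I]
    have hc' : Continuous fun x : ℝ => Complex.exp ((n * Real.pi * x : ℝ) * Complex.I) := by
      fun_prop
    have i1 : IntervalIntegrable
        (fun x : ℝ => Complex.exp (-(n * Real.pi * x : ℝ) * Complex.I) • f₀ x) volume (-1) 1 := by
      rw [intervalIntegrable_iff_integrableOn_Ioc_of_le (by norm_num)]
      exact hint.bdd_smul 1 hc.aestronglyMeasurable (Filter.Eventually.of_forall hb)
    have i2 : IntervalIntegrable
        (fun x : ℝ => Complex.exp (-(n * Real.pi * x : ℝ) * Complex.I) • f₀ (-x))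
        volume (-1) 1 := by
      rw [intervalIntegrable_iff_integrableOn_Ioc_of_le (by norm_num)]
      exact hint'.bdd_smul 1 hc.aestronglyMeasurable (Filter.Eventually.of_forall hb)
    have i3 : IntervalIntegrable
        (fun x : ℝ => Complex.exp ((n * Real.pi * x : ℝ) * Complex.I) • f₀ x) volume (-1) 1 := by
      rw [intervalIntegrable_iff_integrableOn_Ioc_of_le (by norm_num)]
      exact hint.bdd_smul 1 hc'.aestronglyMeasurable (Filter.Eventually.of_forall hb')
    have hsub := intervalIntegral.integral_comp_neg (a := (-1 : ℝ)) (b := 1)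
      (fun x : ℝ => Complex.exp ((n * Real.pi * x : ℝ) * Complex.I) • f₀ x)
    have hneg : ∀ x : ℝ, Complex.exp ((n * Real.pi * (-x) : ℝ) * Complex.I) • f₀ (-x)
        = Complex.exp (-(n * Real.pi * x : ℝ) * Complex.I) • f₀ (-x) := by
      intro x
      congr 3
      push_cast
      ring
    simp only [hneg, neg_neg] at hsub
    simp only [smul_sub]
    rw [intervalIntegral.integral_sub i1 i2, hsub, ← intervalIntegral.integral_sub i1 i3]
    have hfin : ∀ x : ℝ, Complex.exp (-(n * Real.pi * x : ℝ) * Complex.I) • f₀ x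
        - Complex.exp ((n * Real.pi * x : ℝ) * Complex.I) • f₀ x
        = (-2 * Complex.I) * (Real.sin (n * Real.pi * x) • f₀ x) := by
      intro x
      rw [Complex.exp_mul_I, ← Complex.ofReal_neg, Complex.exp_mul_I]
      simp only [← Complex.ofReal_cos, ← Complex.ofReal_sin, Real.cos_neg, Real.sin_neg,
        smul_eq_mul, Complex.real_smul]
      push_cast
      ring
    simp only [hfin]
    rw [intervalIntegral.integral_const_mul, hsin n]
    simp
  have hP := hasSum_sq_fourierCoeffOn (by norm_num : (-1 : ℝ) < 1) (hF.restrict (Ioc (-1) 1))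
  simp only [hcoef, norm_zero, ne_eq, OfNat.ofNat_ne_zero, not_false_eq_true, zero_pow] at hP
  have h0 : ∫ x in (-1 : ℝ)..1, ‖f₀ x - f₀ (-x)‖ ^ 2 = 0 := by
    have := hP.unique hasSum_zero
    rw [smul_eq_zero] at this
    exact this.resolve_left (by norm_num)
  have hsq : Integrable (fun x => ‖f₀ x - f₀ (-x)‖ ^ 2) (volume.restrict (Ioc (-1 : ℝ) 1)) :=
    (memLp_two_iff_integrable_sq_norm hF.aestronglyMeasurable.restrict).1 (hF.restrict _)
  rw [intervalIntegral.integral_of_le (by norm_num), integral_eq_zero_iff_of_nonneg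
    (fun x => by positivity) hsq] at h0
  have h1 : ∀ᵐ x ∂unitMeasure, ‖f₀ x - f₀ (-x)‖ ^ 2 = 0 :=
    ae_restrict_of_ae_restrict_of_subset hsub01 h0
  filter_upwards [h1, ae_restrict_mem measurableSet_Ioo] with x hx hx'
  have h5 : f₀ (-x) = 0 := indicator_of_notMem (fun hh => by linarith [hh.1, hx'.1]) _
  have h6 : f₀ x = φ (f x) := indicator_of_mem hx' _
  rw [h5, h6, sub_zero, sq_eq_zero_iff, norm_eq_zero] at hx
  have h7 : φ (f x) = RCLike.re (f x) + RCLike.im (f x) * Complex.I := by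
    simp [hφ]
  rw [h7] at hx
  have hre := congrArg Complex.re hx
  have him := congrArg Complex.im hx
  simp at hre him
  exact RCLike.ext (by simpa using hre) (by simpa using him)

/-- The weighted sine coefficients `n ^ α * f̂(n)` of a square integrable function. -/
def weightedCoeff (𝕜 : Type*) [RCLike 𝕜] (α : ℝ) : Lp 𝕜 2 unitMeasure →ₗ[𝕜] (ℕ+ → 𝕜) where
  toFun f n := (((n : ℕ) : ℝ) ^ α) • sineCoeff f n
  map_add' f g := by
    funext n
    simp only [sineCoeff_add, smul_add, Pi.add_apply]
  map_smul' c f := by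
    funext n
    simp only [sineCoeff_smul, Pi.smul_apply, RingHom.id_apply, smul_eq_mul, mul_smul_comm]

theorem norm_weightedCoeff_sq {𝕜 : Type*} [RCLike 𝕜] (α : ℝ) (f : Lp 𝕜 2 unitMeasure) (n : ℕ+) :
    ‖weightedCoeff 𝕜 α f n‖ ^ 2 = ((n : ℕ) : ℝ) ^ (2 * α) * ‖sineCoeff f n‖ ^ 2 := by
  have hn : (0 : ℝ) ≤ (n : ℕ) := Nat.cast_nonneg _
  simp only [weightedCoeff, LinearMap.coe_mk, AddHom.coe_mk, norm_smul, mul_pow, Real.norm_eq_abs,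
    sq_abs]
  rw [mul_comm 2 α, Real.rpow_mul hn, Real.rpow_two]

theorem memℓp_weightedCoeff_iff {𝕜 : Type*} [RCLike 𝕜] (α : ℝ) (f : Lp 𝕜 2 unitMeasure) :
    Memℓp (weightedCoeff 𝕜 α f) 2 ↔
      Summable fun n : ℕ+ => ((n : ℕ) : ℝ) ^ (2 * α) * ‖sineCoeff f n‖ ^ 2 := by
  rw [memℓp_gen_iff (by norm_num)]
  simp only [ENNReal.toReal_ofNat, Real.rpow_two, norm_weightedCoeff_sq]

/-- The functions `f ∈ L²(0, 1)` with `∑ n ^ (2 α) |f̂(n)|² < ∞`, as a subspace of `L²(0, 1)`. -/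
def sobolevSubmodule (𝕜 : Type*) [RCLike 𝕜] (α : ℝ) : Submodule 𝕜 (Lp 𝕜 2 unitMeasure) where
  carrier := {f | Summable fun n : ℕ+ => ((n : ℕ) : ℝ) ^ (2 * α) * ‖sineCoeff f n‖ ^ 2}
  add_mem' {f g} hf hg := by
    simp only [mem_ofPred_eq, ← memℓp_weightedCoeff_iff] at *
    rw [map_add]
    exact hf.add hg
  zero_mem' := by
    simp only [mem_ofPred_eq, ← memℓp_weightedCoeff_iff, map_zero]
    exact zero_memℓp
  smul_mem' c f hf := by
    simp only [mem_ofPred_eq, ← memℓp_weightedCoeff_iff] at *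
    rw [map_smul]
    exact hf.const_smul c

/-- The Sobolev space `H^α(0, 1)`: a copy of `sobolevSubmodule`, which carries the norm
`‖f‖ = (∑ n ^ (2 α) |f̂(n)|²) ^ (1/2)` (see `SobolevH.norm_eq`) and not the norm of `L²`. -/
def SobolevH (𝕜 : Type*) [RCLike 𝕜] (α : ℝ) : Type _ := ↥(sobolevSubmodule 𝕜 α)

namespace SobolevH

instance instAddCommGroup (𝕜 : Type*) [RCLike 𝕜] (α : ℝ) : AddCommGroup (SobolevH 𝕜 α) :=
  inferInstanceAs (AddCommGroup ↥(sobolevSubmodule 𝕜 α))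

instance instModule (𝕜 : Type*) [RCLike 𝕜] (α : ℝ) : Module 𝕜 (SobolevH 𝕜 α) :=
  inferInstanceAs (Module 𝕜 ↥(sobolevSubmodule 𝕜 α))

/-- The underlying square integrable function of an element of `H^α`. -/
def toL2 {𝕜 : Type*} [RCLike 𝕜] {α : ℝ} : SobolevH 𝕜 α →ₗ[𝕜] Lp 𝕜 2 unitMeasure :=
  (sobolevSubmodule 𝕜 α).subtype

/-- The square summable sequence `n ^ α * f̂(n)` of an element of `H^α`. -/
def toSeq (𝕜 : Type*) [RCLike 𝕜] (α : ℝ) : SobolevH 𝕜 α →ₗ[𝕜] lp (fun _ : ℕ+ => 𝕜) 2 where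
  toFun f := ⟨weightedCoeff 𝕜 α (toL2 f), (memℓp_weightedCoeff_iff α (toL2 f)).2 f.2⟩
  map_add' f g := by
    ext n
    simp only [map_add, lp.coeFn_add, Pi.add_apply]
  map_smul' c f := by
    ext n
    simp only [map_smul, lp.coeFn_smul, Pi.smul_apply, RingHom.id_apply]

theorem toSeq_injective (𝕜 : Type*) [RCLike 𝕜] (α : ℝ) : Function.Injective (toSeq 𝕜 α) := by
  rw [injective_iff_map_eq_zero]
  intro f hf
  have h : ∀ n, sineCoeff (toL2 f) n = 0 := by
    intro n
    have h1 : (((n : ℕ) : ℝ) ^ α) • sineCoeff (toL2 f) n = 0 := congrArg (fun g => g n) hf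
    have h2 : (0 : ℝ) < (n : ℕ) := Nat.cast_pos.2 n.pos
    exact (smul_eq_zero.1 h1).resolve_left (Real.rpow_pos_of_pos h2 α).ne'
  have h0 : toL2 f = 0 := by
    refine Lp.ext ((ae_zero_of_sineCoeff_eq_zero (Lp.memLp _) h).trans ?_)
    exact (Lp.coeFn_zero 𝕜 2 unitMeasure).symm
  exact Subtype.ext h0

instance instNormedAddCommGroup (𝕜 : Type*) [RCLike 𝕜] (α : ℝ) :
    NormedAddCommGroup (SobolevH 𝕜 α) :=
  NormedAddCommGroup.induced (SobolevH 𝕜 α) (lp (fun _ : ℕ+ => 𝕜) 2) (toSeq 𝕜 α)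
    (toSeq_injective 𝕜 α)

instance instNormedSpace (𝕜 : Type*) [RCLike 𝕜] (α : ℝ) : NormedSpace 𝕜 (SobolevH 𝕜 α) :=
  NormedSpace.induced 𝕜 (SobolevH 𝕜 α) (lp (fun _ : ℕ+ => 𝕜) 2) (toSeq 𝕜 α)

theorem norm_eq {𝕜 : Type*} [RCLike 𝕜] {α : ℝ} (f : SobolevH 𝕜 α) :
    ‖f‖ = Real.sqrt (∑' n : ℕ+, ((n : ℕ) : ℝ) ^ (2 * α) * ‖sineCoeff (toL2 f) n‖ ^ 2) := by
  have h : ‖f‖ = ‖toSeq 𝕜 α f‖ := rfl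
  rw [h, lp.norm_eq_tsum_rpow (by norm_num), Real.sqrt_eq_rpow]
  simp only [ENNReal.toReal_ofNat, Real.rpow_two, ← norm_weightedCoeff_sq]
  rfl

end SobolevH

/-- The functions `v n`, `n = 1, 2, …`, are (representatives of) the members of an unconditional
Schauder basis of the Hilbert space `H^α(0, 1)`. -/
def IsSobolevBasis (𝕜 : Type*) [RCLike 𝕜] (α : ℝ) (v : ℕ+ → ℝ → 𝕜) : Prop :=
  ∃ b : UnconditionalSchauderBasis ℕ+ 𝕜 (SobolevH 𝕜 α),
    ∀ n, (SobolevH.toL2 (b n) : ℝ → 𝕜) =ᵐ[unitMeasure] v n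

/-! ### The Jacobi elliptic sine -/

/-- The elliptic integral `∫₀ᶻ (1 - t²)^(-1/2) (1 - μ² t²)^(-1/2) dt` of the first kind. -/
def ellipticF (μ z : ℝ) : ℝ :=
  ∫ t in (0 : ℝ)..z, (Real.sqrt (1 - t ^ 2))⁻¹ * (Real.sqrt (1 - μ ^ 2 * t ^ 2))⁻¹

/-- The complete elliptic integral of the first kind, with modulus `μ`. -/
def ellipticK (μ : ℝ) : ℝ := ellipticF μ 1

/-- The nome of the modulus `μ`. -/
def nome (μ : ℝ) : ℝ :=
  Real.exp (-Real.pi * ellipticK (Real.sqrt (1 - μ ^ 2)) / ellipticK μ)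

/-- The inverse of `ellipticF μ : [0, 1] → [0, K(μ)]`. -/
def snQuarter (μ y : ℝ) : ℝ := Function.invFunOn (ellipticF μ) (Icc 0 1) y

/-- `sn(·, μ)`: the extension of `snQuarter μ` from `[0, K]` to the real line that is odd,
symmetric about `K` and `4K`-periodic. The variable `z` below is `y` reduced modulo `4K` to
`[0, 4K)`. -/
def jacobiSn (y μ : ℝ) : ℝ :=
  let K := ellipticK μ
  let z := 4 * K * Int.fract (y / (4 * K))
  if z ≤ K then snQuarter μ z
  else if z ≤ 2 * K then snQuarter μ (2 * K - z)
  else if z ≤ 3 * K then -snQuarter μ (z - 2 * K)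
  else -snQuarter μ (4 * K - z)

/-! ### The Gross–Pitaevskii eigenvalue problem -/

/-- `u` is an eigenfunction, with eigenvalue `η`, of the Dirichlet problem
`u'' - u³ + η u = 0`, `u(0) = u(1) = 0`. -/
structure IsGPEigenfunction (u : ℝ → ℝ) (η : ℝ) : Prop where
  contDiffOn : ContDiffOn ℝ 2 u (Icc 0 1)
  equation : ∀ x ∈ Ioo (0 : ℝ) 1, deriv (deriv u) x - u x ^ 3 + η * u x = 0
  left : u 0 = 0
  right : u 1 = 0
  nontrivial : ∃ x ∈ Ioo (0 : ℝ) 1, u x ≠ 0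

/-- `u_n(x, μ) = 2^(3/2) n μ K(μ) sn(2 K(μ) n x, μ)`. -/
def gpFun (n : ℕ+) (μ x : ℝ) : ℝ :=
  2 ^ (3 / 2 : ℝ) * (n : ℕ) * μ * ellipticK μ * jacobiSn (2 * ellipticK μ * (n : ℕ) * x) μ

/-- `η_n(μ) = 4 n² (1 + μ²) K(μ)²`. -/
def gpEigenvalue (n : ℕ+) (μ : ℝ) : ℝ :=
  4 * ((n : ℕ) : ℝ) ^ 2 * (1 + μ ^ 2) * ellipticK μ ^ 2

/-! ### The threshold -/

/-- `s_α(q) = ∑_{l ≥ 0} (2l + 1)^α (1 - q) q^l / (1 - q^(2l + 1))`. -/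
def sSeries (α q : ℝ) : ℝ :=
  ∑' l : ℕ, (2 * (l : ℝ) + 1) ^ α * ((1 - q) * q ^ l / (1 - q ^ (2 * l + 1)))

/-- `r` solves, in `(0, 1)`, the equation
`s_α(q) = 2 + p^α (1 - q) q^((p² - 1)/2) / (2 (1 - q^(p²)))` (for odd `p`, so that the division in
the exponent is exact). -/
def IsThreshold (p : ℕ+) (α r : ℝ) : Prop :=
  r ∈ Ioo (0 : ℝ) 1 ∧
    sSeries α r = 2 + ((p : ℕ) : ℝ) ^ α * (1 - r) * r ^ (((p : ℕ) ^ 2 - 1) / 2) /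
      (2 * (1 - r ^ ((p : ℕ) ^ 2)))

end

/-!
### The route to the basis property

*The elliptic sine.* Substituting `t = sin φ` turns the elliptic integral into Legendre's
`F(φ) = ∫₀^φ dθ / √(1 - k² sin² θ)`, which is a smooth increasing bijection of the real line. Its
inverse is the amplitude `am`, and `sn = sin ∘ am` (`jacobiSn_eq`). Differentiating twice gives the
Gross–Pitaevskii equation (`isGPEigenfunction_gpFun`).

*The sine series of `sn`.* The coefficients `2π / (k K) · q^(l + 1/2) / (1 - q^(2 l + 1))` are
found by real methods. Landen's transformation `k ↦ 2 √k / (1 + k)`, in the form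
`φ = (ψ + arcsin (k sin ψ)) / 2`, splits the cosine integrals of `dn²` at the new modulus by parity:
those of even order `2 m` are multiples of those of order `m` of `dn²` at the modulus `k`
(`dnSqCosIntegral_two_mul_landenUp`), and those of odd order are multiples of those of `sn'` at the
modulus `k` (`dnSqCosIntegral_odd_landenUp`). The first fact, iterated, moves the modulus to `1`
and, as the order doubles, keeps both `K' ∫ dn²(u) cos(π n u / K) du` and `n K' / K` fixed. In the
limit `dn²` is `sech²`, whose cosine transform is a Beta integral, evaluated by Euler's reflection
formula (`integral_cos_log`). This gives the integrals of `dn²` for every modulus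
(`dnSqCosIntegral_mul_complement`), and the second fact gives those of `sn'`, hence the sine
coefficients of `sn` (`integral_sin_mul_sn`, `sn_eq_tsum`) and of the eigenfunctions
(`sineCoeff_gpFun`).

*The basis property.* The weighted sine coefficients identify `H^α` with `ℓ²` (`sobolevEquiv`).
There `u_n` becomes a non-zero multiple of `A δ_n = ∑_l (2 l + 1)^α b_l(q_n) δ_{(2 l + 1) n}`,
where `b_l(q) = (1 - q) q^l / (1 - q^(2 l + 1))`, so that it suffices that `A` is invertible. Let
`Q = sup q_n`, and let `a` and `c` be the coefficients `(2 l + 1)^α b_l(Q)` at the frequencies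
`2 l + 1 = p` and `2 l + 1 = p²`. Let `B` be half the term of `A` of frequency `p`; its norm is at
most `a / 2 < 1`. As `q_n = q_{pn}`, the square `(1 + B)²` is the sum of the identity, of the term
of frequency `p`, and of a quarter of the square of the latter, which is again a dilation by `p²`.
Since `b` is increasing in `q`, and the term of frequency `p²` is at most the square of the term of
frequency `p` (`sTerm_squareIndex_le`), this gives
`‖A - (1 + B)²‖ ≤ (s_α(Q) - 1 - a - c) + (c / 2 + a² / 4)`,
which is less than `(1 - a / 2)²` precisely if `s_α(Q) < 2 + c / 2`. Then `A` is a
small perturbation of the invertible `(1 + B)²` (`isUnit_of_norm_sub_sq_lt`,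
`exists_isUnit_dilationSeries`).

*The threshold.* Moving the term with `p^α` to the left turns the equation into `∑ w_l b_l(q) = 2`
with positive weights, as `p^α / 2 < p^(2 α)`. The left side is continuous and strictly increasing,
equals `1` at `q = 0` and exceeds `2` near `q = 1`, so that there is exactly one solution
(`existsUnique_isThreshold`), below which `s_α(q) < 2 + p^α b(q) / 2 ≤ 2 + p^(2 α) b(q) / 2`, with
`b` of frequency `p²` (`sSeries_lt_of_lt_threshold`); this is the condition found above.
-/

/-! ### Legendre's form of the elliptic integral and the amplitude -/

/-- Legendre's `Δ(φ) = √(1 - k² sin² φ)`. -/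
noncomputable def legendreDelta (k φ : ℝ) : ℝ := Real.sqrt (1 - k ^ 2 * Real.sin φ ^ 2)

/-- Legendre's normal form `∫₀^φ dθ / √(1 - k² sin² θ)` of the incomplete elliptic integral of the
first kind; unlike `ellipticF k`, it is smooth on the whole real line. -/
noncomputable def legendreF (k φ : ℝ) : ℝ := ∫ θ in (0 : ℝ)..φ, (legendreDelta k θ)⁻¹

/-- The Jacobi amplitude, the inverse function of `legendreF k`, which is a bijection of the real
line if `k ^ 2 < 1`. -/
noncomputable def jacobiAm (k y : ℝ) : ℝ := Function.invFun (legendreF k) y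

section Legendre

variable {k : ℝ}

theorem sq_mul_sin_sq_le (k φ : ℝ) : k ^ 2 * Real.sin φ ^ 2 ≤ k ^ 2 :=
  mul_le_of_le_one_right (sq_nonneg k) (Real.sin_sq_le_one φ)

theorem one_sub_sq_mul_sin_sq_pos (hk : k ^ 2 < 1) (φ : ℝ) : 0 < 1 - k ^ 2 * Real.sin φ ^ 2 := by
  linarith [sq_mul_sin_sq_le k φ]

theorem legendreDelta_pos (hk : k ^ 2 < 1) (φ : ℝ) : 0 < legendreDelta k φ :=
  Real.sqrt_pos.2 (one_sub_sq_mul_sin_sq_pos hk φ)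

theorem legendreDelta_sq (hk : k ^ 2 < 1) (φ : ℝ) :
    legendreDelta k φ ^ 2 = 1 - k ^ 2 * Real.sin φ ^ 2 :=
  Real.sq_sqrt (one_sub_sq_mul_sin_sq_pos hk φ).le

theorem legendreDelta_le_one (k φ : ℝ) : legendreDelta k φ ≤ 1 := by
  rw [legendreDelta, Real.sqrt_le_iff]
  refine ⟨zero_le_one, ?_⟩
  nlinarith [sq_nonneg (k * Real.sin φ)]

theorem legendreDelta_neg (k φ : ℝ) : legendreDelta k (-φ) = legendreDelta k φ := by
  simp [legendreDelta]

theorem legendreDelta_add_pi (k φ : ℝ) : legendreDelta k (φ + Real.pi) = legendreDelta k φ := by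
  simp [legendreDelta, Real.sin_add_pi]

theorem legendreDelta_pi_sub (k φ : ℝ) : legendreDelta k (Real.pi - φ) = legendreDelta k φ := by
  simp [legendreDelta, Real.sin_pi_sub]

theorem continuous_legendreDelta (k : ℝ) : Continuous (legendreDelta k) := by
  unfold legendreDelta; fun_prop

theorem hasDerivAt_legendreDelta (hk : k ^ 2 < 1) (φ : ℝ) :
    HasDerivAt (legendreDelta k)
      (-(k ^ 2 * Real.sin φ * Real.cos φ) / legendreDelta k φ) φ := by
  have h := (((Real.hasDerivAt_sin φ).pow 2).const_mul (k ^ 2)).const_sub 1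
  have h1 := h.sqrt (one_sub_sq_mul_sin_sq_pos hk φ).ne'
  refine h1.congr_deriv ?_
  have h2 := (legendreDelta_pos hk φ).ne'
  change -(k ^ 2 * (↑2 * Real.sin φ ^ (2 - 1) * Real.cos φ)) / (2 * legendreDelta k φ) = _
  field_simp
  push_cast
  ring

theorem continuous_inv_legendreDelta (hk : k ^ 2 < 1) :
    Continuous fun φ => (legendreDelta k φ)⁻¹ :=
  (continuous_legendreDelta k).inv₀ fun φ => (legendreDelta_pos hk φ).ne'

theorem hasDerivAt_legendreF (hk : k ^ 2 < 1) (φ : ℝ) :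
    HasDerivAt (legendreF k) (legendreDelta k φ)⁻¹ φ :=
  ((continuous_inv_legendreDelta hk).integral_hasStrictDerivAt 0 φ).hasDerivAt

theorem continuous_legendreF (hk : k ^ 2 < 1) : Continuous (legendreF k) :=
  continuous_iff_continuousAt.2 fun φ => (hasDerivAt_legendreF hk φ).continuousAt

theorem legendreF_zero (k : ℝ) : legendreF k 0 = 0 := by simp [legendreF]

theorem strictMono_legendreF (hk : k ^ 2 < 1) : StrictMono (legendreF k) :=
  strictMono_of_deriv_pos fun φ => by
    rw [(hasDerivAt_legendreF hk φ).deriv]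
    exact inv_pos.2 (legendreDelta_pos hk φ)

/-- Two differentiable functions with the same derivative and a common value agree. -/
theorem eq_of_hasDerivAt_eq {f g f' : ℝ → ℝ} (hf : ∀ x, HasDerivAt f (f' x) x)
    (hg : ∀ x, HasDerivAt g (f' x) x) {a : ℝ} (ha : f a = g a) (x : ℝ) : f x = g x := by
  have h := is_const_of_deriv_eq_zero (f := fun x => f x - g x)
    (fun x => ((hf x).sub (hg x)).differentiableAt)
    (fun x => ((hf x).sub (hg x)).deriv.trans (sub_self _)) x a
  simp only [ha, sub_self] at h
  exact sub_eq_zero.1 h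

theorem legendreF_neg (hk : k ^ 2 < 1) (φ : ℝ) : legendreF k (-φ) = -legendreF k φ := by
  have h : ∀ x, HasDerivAt (fun x => -legendreF k (-x)) (legendreDelta k x)⁻¹ x := fun x => by
    have h1 := ((hasDerivAt_legendreF hk (-x)).comp x (hasDerivAt_neg x)).neg
    refine h1.congr_deriv ?_
    rw [legendreDelta_neg]; ring
  have := eq_of_hasDerivAt_eq (hasDerivAt_legendreF hk) h (a := 0) (by simp [legendreF_zero]) φ
  linarith

theorem legendreF_add_pi (hk : k ^ 2 < 1) (φ : ℝ) :
    legendreF k (φ + Real.pi) = legendreF k φ + legendreF k Real.pi := by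
  refine eq_of_hasDerivAt_eq (f := fun x => legendreF k (x + Real.pi))
    (g := fun x => legendreF k x + legendreF k Real.pi) (f' := fun x => (legendreDelta k x)⁻¹)
    (fun x => ?_) (fun x => (hasDerivAt_legendreF hk x).add_const _) (a := 0)
    (by simp [legendreF_zero]) φ
  have h1 := (hasDerivAt_legendreF hk (x + Real.pi)).comp_add_const x Real.pi
  rwa [legendreDelta_add_pi] at h1

theorem legendreF_pi_sub (hk : k ^ 2 < 1) (φ : ℝ) :
    legendreF k (Real.pi - φ) = legendreF k Real.pi - legendreF k φ := by
  rw [sub_eq_neg_add, legendreF_add_pi hk, legendreF_neg hk]; ring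

theorem legendreF_pi (hk : k ^ 2 < 1) : legendreF k Real.pi = 2 * legendreF k (Real.pi / 2) := by
  have := legendreF_pi_sub hk (Real.pi / 2)
  rw [sub_half] at this
  linarith

theorem le_legendreF (hk : k ^ 2 < 1) {φ : ℝ} (hφ : 0 ≤ φ) : φ ≤ legendreF k φ := by
  have h : ∫ _ in (0 : ℝ)..φ, (1 : ℝ) ≤ legendreF k φ := by
    refine intervalIntegral.integral_mono_on hφ (by simp)
      ((continuous_inv_legendreDelta hk).intervalIntegrable _ _) fun x _ => ?_
    exact (one_le_inv₀ (legendreDelta_pos hk x)).2 (legendreDelta_le_one k x)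
  simpa using h

theorem surjective_legendreF (hk : k ^ 2 < 1) : Function.Surjective (legendreF k) := by
  refine (continuous_legendreF hk).surjective ?_ ?_
  · refine Filter.tendsto_atTop_mono' _ ?_ Filter.tendsto_id
    filter_upwards [Filter.eventually_ge_atTop 0] with x hx using le_legendreF hk hx
  · refine Filter.tendsto_atBot_mono' _ ?_ Filter.tendsto_id
    filter_upwards [Filter.eventually_le_atBot 0] with x hx
    have h := le_legendreF hk (neg_nonneg.2 hx)
    rw [legendreF_neg hk] at h
    exact neg_le_neg_iff.1 h

theorem legendreF_jacobiAm (hk : k ^ 2 < 1) (y : ℝ) : legendreF k (jacobiAm k y) = y :=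
  Function.invFun_eq (surjective_legendreF hk y)

theorem jacobiAm_legendreF (hk : k ^ 2 < 1) (φ : ℝ) : jacobiAm k (legendreF k φ) = φ :=
  Function.leftInverse_invFun (strictMono_legendreF hk).injective φ

theorem jacobiAm_eq_iff (hk : k ^ 2 < 1) {y φ : ℝ} : jacobiAm k y = φ ↔ y = legendreF k φ :=
  ⟨fun h => by rw [← h, legendreF_jacobiAm hk], fun h => by rw [h, jacobiAm_legendreF hk]⟩

theorem strictMono_jacobiAm (hk : k ^ 2 < 1) : StrictMono (jacobiAm k) := fun x y hxy => by
  rwa [← (strictMono_legendreF hk).lt_iff_lt, legendreF_jacobiAm hk, legendreF_jacobiAm hk]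

theorem continuous_jacobiAm (hk : k ^ 2 < 1) : Continuous (jacobiAm k) :=
  (strictMono_jacobiAm hk).monotone.continuous_of_surjective
    fun φ => ⟨legendreF k φ, jacobiAm_legendreF hk φ⟩

theorem hasDerivAt_jacobiAm (hk : k ^ 2 < 1) (y : ℝ) :
    HasDerivAt (jacobiAm k) (legendreDelta k (jacobiAm k y)) y := by
  have h := HasDerivAt.of_local_left_inverse (continuous_jacobiAm hk).continuousAt
    (hasDerivAt_legendreF hk (jacobiAm k y)) (inv_ne_zero (legendreDelta_pos hk _).ne')
    (Filter.Eventually.of_forall (legendreF_jacobiAm hk))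
  rwa [inv_inv] at h

theorem jacobiAm_zero (hk : k ^ 2 < 1) : jacobiAm k 0 = 0 := by
  rw [jacobiAm_eq_iff hk, legendreF_zero]

/-! ### The elliptic integrals and the elliptic sine in Legendre's form -/

theorem ellipticF_sin {φ : ℝ} (h0 : 0 ≤ φ) (h1 : φ ≤ Real.pi / 2) :
    ellipticF k (Real.sin φ) = legendreF k φ := by
  unfold ellipticF legendreF
  have hcos : ∀ x ∈ Ioo 0 φ, 0 < Real.cos x := fun x hx =>
    Real.cos_pos_of_mem_Ioo ⟨by linarith [hx.1, Real.pi_pos], by linarith [hx.2]⟩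
  have h := intervalIntegral.integral_comp_mul_deriv_of_deriv_nonneg (a := 0) (b := φ)
    (f := Real.sin) (f' := Real.cos)
    (g := fun t => (Real.sqrt (1 - t ^ 2))⁻¹ * (Real.sqrt (1 - k ^ 2 * t ^ 2))⁻¹)
    Real.continuous_sin.continuousOn (fun x _ => Real.hasDerivAt_sin x)
    (fun x hx => by
      rw [min_eq_left h0, max_eq_right h0] at hx
      exact (hcos x hx).le)
  rw [Real.sin_zero] at h
  rw [← h]
  rw [intervalIntegral.integral_of_le h0, intervalIntegral.integral_of_le h0,
    integral_Ioc_eq_integral_Ioo, integral_Ioc_eq_integral_Ioo]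
  refine setIntegral_congr_fun measurableSet_Ioo fun x hx => ?_
  have hc := hcos x hx
  have : Real.sqrt (1 - Real.sin x ^ 2) = Real.cos x := by
    rw [← Real.cos_sq', Real.sqrt_sq hc.le]
  simp only [Function.comp_apply, this, legendreDelta]
  field_simp

theorem ellipticK_eq_legendreF (k : ℝ) : ellipticK k = legendreF k (Real.pi / 2) := by
  rw [ellipticK, ← ellipticF_sin (by positivity) le_rfl, Real.sin_pi_div_two]

theorem ellipticK_pos (hk : k ^ 2 < 1) : 0 < ellipticK k := by
  rw [ellipticK_eq_legendreF, ← legendreF_zero k]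
  exact strictMono_legendreF hk (by positivity)

theorem jacobiAm_two_K_sub (hk : k ^ 2 < 1) (y : ℝ) :
    jacobiAm k (2 * ellipticK k - y) = Real.pi - jacobiAm k y := by
  rw [jacobiAm_eq_iff hk, legendreF_pi_sub hk, legendreF_pi hk, legendreF_jacobiAm hk,
    ellipticK_eq_legendreF]

theorem jacobiAm_add_two_K (hk : k ^ 2 < 1) (y : ℝ) :
    jacobiAm k (y + 2 * ellipticK k) = jacobiAm k y + Real.pi := by
  rw [jacobiAm_eq_iff hk, legendreF_add_pi hk, legendreF_pi hk, legendreF_jacobiAm hk,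
    ellipticK_eq_legendreF]

theorem sin_jacobiAm_antiperiodic (hk : k ^ 2 < 1) :
    Function.Antiperiodic (fun y => Real.sin (jacobiAm k y)) (2 * ellipticK k) := fun y => by
  simp only [jacobiAm_add_two_K hk, Real.sin_add_pi]

theorem jacobiAm_mem_Icc (hk : k ^ 2 < 1) {y : ℝ} (h0 : 0 ≤ y) (h1 : y ≤ ellipticK k) :
    jacobiAm k y ∈ Icc 0 (Real.pi / 2) := by
  constructor
  · rw [← jacobiAm_zero hk]; exact (strictMono_jacobiAm hk).monotone h0
  · rw [ellipticK_eq_legendreF] at h1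
    rw [← jacobiAm_legendreF hk (Real.pi / 2)]; exact (strictMono_jacobiAm hk).monotone h1

theorem injOn_ellipticF (hk : k ^ 2 < 1) : InjOn (ellipticF k) (Icc 0 1) := by
  intro x hx y hy h
  have hx' := Real.sin_arcsin (by linarith [hx.1]) hx.2
  have hy' := Real.sin_arcsin (by linarith [hy.1]) hy.2
  rw [← hx', ← hy', ellipticF_sin (Real.arcsin_nonneg.2 hx.1) (Real.arcsin_le_pi_div_two x),
    ellipticF_sin (Real.arcsin_nonneg.2 hy.1) (Real.arcsin_le_pi_div_two y)] at h
  rw [← hx', ← hy', (strictMono_legendreF hk).injective h]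

theorem snQuarter_eq (hk : k ^ 2 < 1) {y : ℝ} (h0 : 0 ≤ y) (h1 : y ≤ ellipticK k) :
    snQuarter k y = Real.sin (jacobiAm k y) := by
  obtain ⟨ha, hb⟩ := jacobiAm_mem_Icc hk h0 h1
  have hm : Real.sin (jacobiAm k y) ∈ Icc (0 : ℝ) 1 :=
    ⟨Real.sin_nonneg_of_nonneg_of_le_pi ha (by linarith [Real.pi_pos]), Real.sin_le_one _⟩
  have he : ellipticF k (Real.sin (jacobiAm k y)) = y := by
    rw [ellipticF_sin ha hb, legendreF_jacobiAm hk]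
  unfold snQuarter
  conv_lhs => rw [← he]
  exact (injOn_ellipticF hk).leftInvOn_invFunOn hm

/-- The elliptic sine is the sine of the amplitude. -/
theorem jacobiSn_eq (hk : k ^ 2 < 1) (y : ℝ) : jacobiSn y k = Real.sin (jacobiAm k y) := by
  have hK := ellipticK_pos hk
  have hanti := sin_jacobiAm_antiperiodic hk
  have hper : Function.Periodic (fun y => Real.sin (jacobiAm k y)) (4 * ellipticK k) := by
    have h4 : 4 * ellipticK k = 2 • (2 * ellipticK k) := by rw [nsmul_eq_mul]; push_cast; ring
    rw [h4]
    exact hanti.periodic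
  set z := 4 * ellipticK k * Int.fract (y / (4 * ellipticK k)) with hz
  have hz0 : 0 ≤ z := mul_nonneg (by positivity) (Int.fract_nonneg _)
  have hz1 : z < 4 * ellipticK k := mul_lt_of_lt_one_right (by positivity) (Int.fract_lt_one _)
  have hzy : Real.sin (jacobiAm k y) = Real.sin (jacobiAm k z) := by
    have h1 : z = y - ⌊y / (4 * ellipticK k)⌋ * (4 * ellipticK k) := by
      rw [hz, Int.fract]; field_simp
    rw [h1]
    exact (hper.sub_int_mul_eq _).symm
  have hsub : ∀ x, Real.sin (jacobiAm k (2 * ellipticK k - x)) = Real.sin (jacobiAm k x) :=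
    fun x => by rw [jacobiAm_two_K_sub hk, Real.sin_pi_sub]
  rw [hzy, jacobiSn]
  change (if z ≤ ellipticK k then snQuarter k z
    else if z ≤ 2 * ellipticK k then snQuarter k (2 * ellipticK k - z)
    else if z ≤ 3 * ellipticK k then -snQuarter k (z - 2 * ellipticK k)
    else -snQuarter k (4 * ellipticK k - z)) = _
  split_ifs with h1 h2 h3
  · exact snQuarter_eq hk hz0 h1
  · rw [snQuarter_eq hk (by linarith) (by linarith), hsub]
  · rw [snQuarter_eq hk (by linarith) (by linarith)]
    have := hanti (z - 2 * ellipticK k)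
    simp only [sub_add_cancel] at this
    exact this.symm
  · rw [snQuarter_eq hk (by linarith) (by linarith)]
    have h4 := hanti (2 * ellipticK k - z)
    simp only [hsub] at h4
    rw [show 4 * ellipticK k - z = 2 * ellipticK k - z + 2 * ellipticK k by ring, h4, neg_neg]

/-! ### The eigenfunctions -/

theorem hasDerivAt_sin_jacobiAm (hk : k ^ 2 < 1) (y : ℝ) :
    HasDerivAt (fun y => Real.sin (jacobiAm k y))
      (Real.cos (jacobiAm k y) * legendreDelta k (jacobiAm k y)) y :=
  (Real.hasDerivAt_sin _).comp y (hasDerivAt_jacobiAm hk y)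

theorem hasDerivAt_cos_mul_delta_jacobiAm (hk : k ^ 2 < 1) (y : ℝ) :
    HasDerivAt (fun y => Real.cos (jacobiAm k y) * legendreDelta k (jacobiAm k y))
      (-(1 + k ^ 2) * Real.sin (jacobiAm k y) + 2 * k ^ 2 * Real.sin (jacobiAm k y) ^ 3) y := by
  have h1 := (Real.hasDerivAt_cos _).comp y (hasDerivAt_jacobiAm hk y)
  have h2 := (hasDerivAt_legendreDelta hk _).comp y (hasDerivAt_jacobiAm hk y)
  refine (h1.mul h2).congr_deriv ?_
  have h3 := (legendreDelta_pos hk (jacobiAm k y)).ne'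
  have h4 := legendreDelta_sq hk (jacobiAm k y)
  have h5 := Real.cos_sq' (jacobiAm k y)
  simp only [Function.comp_apply]
  rw [div_mul_cancel₀ _ h3]
  linear_combination (-Real.sin (jacobiAm k y)) * h4
    + (- k ^ 2 * Real.sin (jacobiAm k y)) * h5

end Legendre

theorem isGPEigenfunction_gpFun (n : ℕ+) {μ : ℝ} (hμ : μ ∈ Ioo (0 : ℝ) 1) :
    IsGPEigenfunction (gpFun n μ) (gpEigenvalue n μ) := by
  have hk : μ ^ 2 < 1 := by nlinarith [hμ.1, hμ.2]
  have hK := ellipticK_pos hk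
  have hn : (0 : ℝ) < (n : ℕ) := Nat.cast_pos.2 n.pos
  set K := ellipticK μ with hKdef
  set c : ℝ := 2 ^ (3 / 2 : ℝ) * (n : ℕ) * μ * K with hc
  set w : ℝ := 2 * K * (n : ℕ) with hw
  have hc0 : 0 < c := by have := hμ.1; positivity
  have h2 : ((2 : ℝ) ^ (3 / 2 : ℝ)) ^ 2 = 8 := by
    rw [← Real.rpow_natCast, ← Real.rpow_mul (by norm_num)]; norm_num
  have hu : gpFun n μ = fun x => c * Real.sin (jacobiAm μ (w * x)) := by
    funext x
    rw [gpFun, jacobiSn_eq hk]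
  have hwx : ∀ x, HasDerivAt (fun x => w * x) w x := fun x => by
    simpa using (hasDerivAt_id x).const_mul w
  have hd1 : ∀ x, HasDerivAt (gpFun n μ)
      (c * (Real.cos (jacobiAm μ (w * x)) * legendreDelta μ (jacobiAm μ (w * x)) * w)) x := by
    intro x
    rw [hu]
    exact ((hasDerivAt_sin_jacobiAm hk (w * x)).comp x (hwx x)).const_mul c
  have hd1' : deriv (gpFun n μ) = fun x =>
      c * (Real.cos (jacobiAm μ (w * x)) * legendreDelta μ (jacobiAm μ (w * x)) * w) :=
    funext fun x => (hd1 x).deriv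
  have hd2 : ∀ x, HasDerivAt (deriv (gpFun n μ))
      (c * ((-(1 + μ ^ 2) * Real.sin (jacobiAm μ (w * x))
        + 2 * μ ^ 2 * Real.sin (jacobiAm μ (w * x)) ^ 3) * w * w)) x := by
    intro x
    rw [hd1']
    exact (((hasDerivAt_cos_mul_delta_jacobiAm hk (w * x)).comp x (hwx x)).mul_const w).const_mul c
  have hd2' := funext fun x => (hd2 x).deriv
  have ham : Continuous fun x => jacobiAm μ (w * x) := (continuous_jacobiAm hk).comp (by fun_prop)
  refine ⟨?_, fun x _ => ?_, ?_, ?_, ?_⟩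
  · refine ContDiff.contDiffOn ?_
    rw [show (2 : WithTop ℕ∞) = 1 + 1 by norm_num, contDiff_succ_iff_deriv]
    refine ⟨fun x => (hd1 x).differentiableAt, by simp, ?_⟩
    rw [contDiff_one_iff_deriv]
    refine ⟨fun x => (hd2 x).differentiableAt, ?_⟩
    rw [hd2']
    fun_prop
  · rw [(hd2 x).deriv, hu, gpEigenvalue]
    have h3 : c ^ 2 = 2 * μ ^ 2 * w ^ 2 := by rw [hc, hw, mul_pow, mul_pow, mul_pow, h2]; ring
    have h4 : w ^ 2 = 4 * ((n : ℕ) : ℝ) ^ 2 * K ^ 2 := by rw [hw]; ring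
    simp only [← hKdef]
    linear_combination (-c * Real.sin (jacobiAm μ (w * x)) ^ 3) * h3
      - (1 + μ ^ 2) * c * Real.sin (jacobiAm μ (w * x)) * h4
  · rw [hu]; simp [jacobiAm_zero hk]
  · have h := (sin_jacobiAm_antiperiodic hk).add_nat_mul_eq (x := 0) (n : ℕ)
    simp only [zero_add, jacobiAm_zero hk, Real.sin_zero, mul_zero] at h
    rw [hu]
    simp only [mul_one]
    rw [show w = (n : ℕ) * (2 * ellipticK μ) by rw [hw, hKdef]; ring, h, mul_zero]
  · refine ⟨1 / (2 * (n : ℕ)), ⟨by positivity, ?_⟩, ?_⟩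
    · rw [div_lt_one (by positivity)]
      have : (1 : ℝ) ≤ (n : ℕ) := Nat.one_le_cast.2 n.pos
      linarith
    · rw [hu]
      have : w * (1 / (2 * (n : ℕ))) = legendreF μ (Real.pi / 2) := by
        rw [← ellipticK_eq_legendreF, hw]; field_simp; exact hKdef
      simp only [this, jacobiAm_legendreF hk, Real.sin_pi_div_two, mul_one]
      exact hc0.ne'

/-! ### The Landen transformation -/

/-- The ascending Landen transform `2 √k / (1 + k)` of a modulus; it takes the nome to its square
root. -/
noncomputable def landenUp (k : ℝ) : ℝ := 2 * Real.sqrt k / (1 + k)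

/-- The amplitude `φ` with `sin (2 φ - ψ) = k sin ψ`, which corresponds under the ascending Landen
transformation to the amplitude `ψ` for the modulus `k`. -/
noncomputable def landenAmplitude (k ψ : ℝ) : ℝ := (ψ + Real.arcsin (k * Real.sin ψ)) / 2

/-- The integral `∫₀^K dn²(u) cos(π n u / K) du`, written in the variable `φ = am u`. -/
noncomputable def dnSqCosIntegral (n : ℕ) (k : ℝ) : ℝ :=
  ∫ φ in (0 : ℝ)..Real.pi / 2,
    legendreDelta k φ * Real.cos (Real.pi * n * legendreF k φ / ellipticK k)

/-- The integral `∫₀^K sn'(u) cos(π n u / (2 K)) du`, written in the variable `φ = am u`. -/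
noncomputable def snDerivCosIntegral (n : ℕ) (k : ℝ) : ℝ :=
  ∫ φ in (0 : ℝ)..Real.pi / 2,
    Real.cos φ * Real.cos (Real.pi * n * legendreF k φ / (2 * ellipticK k))

section Landen

variable {k : ℝ}

theorem sq_lt_one_of_mem_Ioo (hk : k ∈ Ioo (0 : ℝ) 1) : k ^ 2 < 1 := by nlinarith [hk.1, hk.2]

theorem one_sub_landenUp (hk : 0 ≤ k) :
    1 - landenUp k = (1 - Real.sqrt k) ^ 2 / (1 + k) := by
  have h := Real.sq_sqrt hk
  rw [landenUp]
  field_simp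
  linear_combination -h

theorem landenUp_mem (hk : k ∈ Ioo (0 : ℝ) 1) : landenUp k ∈ Ioo (0 : ℝ) 1 := by
  have h0 := hk.1
  have hs : 0 < Real.sqrt k := Real.sqrt_pos.2 h0
  have hs1 : Real.sqrt k < 1 := by rw [Real.sqrt_lt' one_pos]; simpa using hk.2
  refine ⟨by unfold landenUp; positivity, ?_⟩
  have h := one_sub_landenUp h0.le
  have : 0 < (1 - Real.sqrt k) ^ 2 / (1 + k) := by
    have : 0 < 1 - Real.sqrt k := by linarith
    positivity
  linarith

theorem landenUp_sq (hk : 0 ≤ k) : landenUp k ^ 2 = 4 * k / (1 + k) ^ 2 := by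
  rw [landenUp, div_pow, mul_pow, Real.sq_sqrt hk]; norm_num

theorem sqrt_one_sub_sq_mem (hk : k ∈ Ioo (0 : ℝ) 1) : Real.sqrt (1 - k ^ 2) ∈ Ioo (0 : ℝ) 1 := by
  have h0 := sq_lt_one_of_mem_Ioo hk
  refine ⟨Real.sqrt_pos.2 (by linarith), ?_⟩
  rw [Real.sqrt_lt' one_pos]
  nlinarith [hk.1]

theorem sqrt_one_sub_landenUp_sq (hk : k ∈ Ioo (0 : ℝ) 1) :
    Real.sqrt (1 - landenUp k ^ 2) = (1 - k) / (1 + k) := by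
  have h0 := hk.1
  have h1 : 0 < 1 - k := by linarith [hk.2]
  rw [landenUp_sq h0.le, show 1 - 4 * k / (1 + k) ^ 2 = ((1 - k) / (1 + k)) ^ 2 by field_simp; ring,
    Real.sqrt_sq (by positivity)]

theorem landenUp_sqrt_one_sub_landenUp_sq (hk : k ∈ Ioo (0 : ℝ) 1) :
    landenUp (Real.sqrt (1 - landenUp k ^ 2)) = Real.sqrt (1 - k ^ 2) := by
  have h0 := hk.1
  have h1 : 0 < 1 - k := by linarith [hk.2]
  have h2 : 0 ≤ (1 - k) / (1 + k) := by positivity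
  have h3 : 0 ≤ landenUp ((1 - k) / (1 + k)) := by unfold landenUp; positivity
  rw [sqrt_one_sub_landenUp_sq hk, eq_comm, Real.sqrt_eq_iff_mul_self_eq (by nlinarith) h3, ← sq,
    landenUp_sq h2]
  field_simp
  ring

theorem abs_mul_cos_lt_legendreDelta (hk : k ^ 2 < 1) (ψ : ℝ) :
    |k * Real.cos ψ| < legendreDelta k ψ := by
  refine abs_lt_of_sq_lt_sq ?_ (legendreDelta_pos hk ψ).le
  rw [legendreDelta_sq hk, mul_pow, Real.cos_sq']
  linarith

theorem cos_two_mul_landenAmplitude (hk : k ^ 2 < 1) (ψ : ℝ) :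
    Real.cos (2 * landenAmplitude k ψ) =
      Real.cos ψ * legendreDelta k ψ - k * Real.sin ψ ^ 2 := by
  have habs : |k * Real.sin ψ| ≤ 1 := by
    rw [← sq_le_one_iff_abs_le_one, mul_pow]
    linarith [sq_mul_sin_sq_le k ψ]
  rw [abs_le] at habs
  rw [landenAmplitude, mul_div_cancel₀ _ two_ne_zero, Real.cos_add, Real.cos_arcsin,
    Real.sin_arcsin habs.1 habs.2, legendreDelta, mul_pow]
  ring

theorem legendreDelta_landenAmplitude (hk : k ∈ Ioo (0 : ℝ) 1) (ψ : ℝ) :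
    legendreDelta (landenUp k) (landenAmplitude k ψ) =
      (legendreDelta k ψ + k * Real.cos ψ) / (1 + k) := by
  have h0 := hk.1
  have hk2 := sq_lt_one_of_mem_Ioo hk
  have hpos : 0 < legendreDelta k ψ + k * Real.cos ψ := by
    linarith [(abs_lt.1 (abs_mul_cos_lt_legendreDelta hk2 ψ)).1]
  have hc := cos_two_mul_landenAmplitude hk2 ψ
  have hd := legendreDelta_sq hk2 ψ
  have hcs := Real.cos_sq' ψ
  rw [Real.cos_two_mul'] at hc
  have hsc := Real.cos_sq' (landenAmplitude k ψ)
  have hs : Real.sin (landenAmplitude k ψ) ^ 2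
      = (1 - (Real.cos ψ * legendreDelta k ψ - k * Real.sin ψ ^ 2)) / 2 := by linarith
  rw [legendreDelta, Real.sqrt_eq_iff_mul_self_eq
    (one_sub_sq_mul_sin_sq_pos (sq_lt_one_of_mem_Ioo (landenUp_mem hk)) _).le (by positivity), ← sq,
    landenUp_sq h0.le, hs, div_pow]
  field_simp
  linear_combination -2 * hd - 2 * k ^ 2 * hcs

theorem hasDerivAt_landenAmplitude (hk : k ^ 2 < 1) (ψ : ℝ) :
    HasDerivAt (landenAmplitude k)
      ((legendreDelta k ψ + k * Real.cos ψ) / (2 * legendreDelta k ψ)) ψ := by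
  have hlt : (k * Real.sin ψ) ^ 2 < 1 := by
    rw [mul_pow]; linarith [sq_mul_sin_sq_le k ψ]
  have h1 : k * Real.sin ψ ≠ -1 := fun h => by rw [h] at hlt; norm_num at hlt
  have h2 : k * Real.sin ψ ≠ 1 := fun h => by rw [h] at hlt; norm_num at hlt
  have h := ((hasDerivAt_id ψ).add ((Real.hasDerivAt_arcsin h1 h2).comp ψ
    ((Real.hasDerivAt_sin ψ).const_mul k))).div_const 2
  refine h.congr_deriv ?_
  have h3 := (legendreDelta_pos hk ψ).ne'
  rw [mul_pow]
  change (1 + 1 / legendreDelta k ψ * (k * Real.cos ψ)) / 2 = _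
  field_simp

theorem landenAmplitude_zero (k : ℝ) : landenAmplitude k 0 = 0 := by simp [landenAmplitude]

theorem landenAmplitude_pi (k : ℝ) : landenAmplitude k Real.pi = Real.pi / 2 := by
  simp [landenAmplitude]

/-- Landen's transformation of the elliptic integral. -/
theorem legendreF_landenAmplitude (hk : k ∈ Ioo (0 : ℝ) 1) (ψ : ℝ) :
    legendreF (landenUp k) (landenAmplitude k ψ) = (1 + k) / 2 * legendreF k ψ := by
  have hk2 := sq_lt_one_of_mem_Ioo hk
  refine eq_of_hasDerivAt_eq (f := fun ψ => legendreF (landenUp k) (landenAmplitude k ψ))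
    (f' := fun ψ => (1 + k) / 2 * (legendreDelta k ψ)⁻¹)
    (fun x => ?_) (fun x => (hasDerivAt_legendreF hk2 x).const_mul ((1 + k) / 2)) (a := 0)
    (by simp [legendreF_zero, landenAmplitude_zero]) ψ
  have h := (hasDerivAt_legendreF (sq_lt_one_of_mem_Ioo (landenUp_mem hk)) _).comp x
    (hasDerivAt_landenAmplitude hk2 x)
  refine h.congr_deriv ?_
  have hpos : 0 < legendreDelta k x + k * Real.cos x := by
    linarith [(abs_lt.1 (abs_mul_cos_lt_legendreDelta hk2 x)).1]
  have h3 := legendreDelta_pos hk2 x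
  have h0 := hk.1
  rw [legendreDelta_landenAmplitude hk]
  field_simp

theorem ellipticK_landenUp (hk : k ∈ Ioo (0 : ℝ) 1) :
    ellipticK (landenUp k) = (1 + k) * ellipticK k := by
  have h := legendreF_landenAmplitude hk Real.pi
  rw [landenAmplitude_pi, legendreF_pi (sq_lt_one_of_mem_Ioo hk)] at h
  rw [ellipticK_eq_legendreF, ellipticK_eq_legendreF, h]
  ring

/-- The complementary modulus undergoes the inverse transformation. -/
theorem ellipticK_complement_landenUp (hk : k ∈ Ioo (0 : ℝ) 1) :
    ellipticK (Real.sqrt (1 - landenUp k ^ 2)) =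
      (1 + k) / 2 * ellipticK (Real.sqrt (1 - k ^ 2)) := by
  have h := ellipticK_landenUp (sqrt_one_sub_sq_mem (landenUp_mem hk))
  rw [landenUp_sqrt_one_sub_landenUp_sq hk] at h
  rw [h, sqrt_one_sub_landenUp_sq hk]
  have := hk.1
  field_simp
  ring

theorem integral_zero_pi_eq {h : ℝ → ℝ} (hh : Continuous h) :
    ∫ x in (0 : ℝ)..Real.pi, h x = ∫ x in (0 : ℝ)..Real.pi / 2, (h x + h (Real.pi - x)) := by
  have h1 : ∫ x in (0 : ℝ)..Real.pi / 2, h (Real.pi - x) = ∫ x in Real.pi / 2..Real.pi, h x := by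
    rw [intervalIntegral.integral_comp_sub_left, sub_zero, sub_half]
  have hh' : Continuous fun x => h (Real.pi - x) := by fun_prop
  rw [intervalIntegral.integral_add (hh.intervalIntegrable _ _) (hh'.intervalIntegrable _ _), h1,
    intervalIntegral.integral_add_adjacent_intervals (hh.intervalIntegrable _ _)
      (hh.intervalIntegrable _ _)]

theorem continuous_cos_legendreF (hk : k ^ 2 < 1) (a b : ℝ) :
    Continuous fun φ => Real.cos (a * legendreF k φ / b) :=
  Real.continuous_cos.comp (((continuous_legendreF hk).const_mul a).div_const b)

theorem cos_legendreF_pi_sub (hk : k ^ 2 < 1) (n : ℕ) (φ : ℝ) :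
    Real.cos (Real.pi * n * legendreF k (Real.pi - φ) / (2 * ellipticK k)) =
      (-1) ^ n * Real.cos (Real.pi * n * legendreF k φ / (2 * ellipticK k)) := by
  have hK := ellipticK_pos hk
  have : Real.pi * n * legendreF k (Real.pi - φ) / (2 * ellipticK k)
      = n * Real.pi - Real.pi * n * legendreF k φ / (2 * ellipticK k) := by
    rw [legendreF_pi_sub hk, legendreF_pi hk, ← ellipticK_eq_legendreF]
    field_simp
  rw [this, Real.cos_sub, Real.cos_nat_mul_pi, Real.sin_nat_mul_pi]
  ring

/-- The substitution of `landenAmplitude k ψ` for `φ`, with `ψ` running through two quarter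
periods. -/
theorem dnSqCosIntegral_landenUp (hk : k ∈ Ioo (0 : ℝ) 1) (n : ℕ) :
    dnSqCosIntegral n (landenUp k) = 1 / (2 * (1 + k)) * ∫ ψ in (0 : ℝ)..Real.pi,
      (legendreDelta k ψ + k * Real.cos ψ) ^ 2 / legendreDelta k ψ *
        Real.cos (Real.pi * n * legendreF k ψ / (2 * ellipticK k)) := by
  have h0 := hk.1
  have hk2 := sq_lt_one_of_mem_Ioo hk
  have hk2' := sq_lt_one_of_mem_Ioo (landenUp_mem hk)
  have hK := ellipticK_pos hk2
  have hsub := intervalIntegral.integral_comp_mul_deriv (a := 0) (b := Real.pi)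
    (fun x _ => hasDerivAt_landenAmplitude hk2 x)
    (Continuous.continuousOn (((continuous_legendreDelta k).add (by fun_prop)).div
      ((continuous_legendreDelta k).const_mul 2)
      fun x => (mul_pos two_pos (legendreDelta_pos hk2 x)).ne'))
    ((continuous_legendreDelta (landenUp k)).mul
      (continuous_cos_legendreF hk2' (Real.pi * n) (ellipticK (landenUp k))))
  rw [landenAmplitude_zero, landenAmplitude_pi] at hsub
  rw [dnSqCosIntegral]
  refine hsub.symm.trans ?_
  rw [← intervalIntegral.integral_const_mul]
  refine intervalIntegral.integral_congr fun x _ => ?_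
  have h3 := legendreDelta_pos hk2 x
  simp only [Function.comp_apply, Pi.mul_apply]
  rw [legendreF_landenAmplitude hk, legendreDelta_landenAmplitude hk, ellipticK_landenUp hk,
    show Real.pi * n * ((1 + k) / 2 * legendreF k x) / ((1 + k) * ellipticK k)
      = Real.pi * n * legendreF k x / (2 * ellipticK k) by field_simp]
  field_simp

theorem integral_inv_legendreDelta_mul_cos (hk : k ^ 2 < 1) {n : ℕ} (hn : n ≠ 0) :
    ∫ φ in (0 : ℝ)..Real.pi / 2, (legendreDelta k φ)⁻¹ *
      Real.cos (Real.pi * n * legendreF k φ / ellipticK k) = 0 := by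
  have hK := ellipticK_pos hk
  have hn' : (n : ℝ) ≠ 0 := Nat.cast_ne_zero.2 hn
  have h : ∀ x, HasDerivAt (fun φ => ellipticK k / (Real.pi * n) *
      Real.sin (Real.pi * n * legendreF k φ / ellipticK k))
      ((legendreDelta k x)⁻¹ * Real.cos (Real.pi * n * legendreF k x / ellipticK k)) x := by
    intro x
    have h1 := ((Real.hasDerivAt_sin _).comp x
      (((hasDerivAt_legendreF hk x).const_mul (Real.pi * n)).div_const (ellipticK k))).const_mul
        (ellipticK k / (Real.pi * n))
    refine h1.congr_deriv ?_
    have := Real.pi_pos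
    field_simp
  rw [intervalIntegral.integral_eq_sub_of_hasDerivAt (fun x _ => h x)
    (((continuous_inv_legendreDelta hk).mul (continuous_cos_legendreF hk _ _)).intervalIntegrable
      _ _), legendreF_zero, ← ellipticK_eq_legendreF, mul_div_assoc, div_self hK.ne', mul_one,
    mul_comm Real.pi, Real.sin_nat_mul_pi]
  simp

/-- The part of `dn²` which is periodic with half the period is again of the form `dn²`, with the
modulus of Landen's transformation. -/
theorem dnSqCosIntegral_two_mul_landenUp (hk : k ∈ Ioo (0 : ℝ) 1) {m : ℕ} (hm : m ≠ 0) :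
    dnSqCosIntegral (2 * m) (landenUp k) = 2 / (1 + k) * dnSqCosIntegral m k := by
  have h0 := hk.1
  have hk2 := sq_lt_one_of_mem_Ioo hk
  have hK := ellipticK_pos hk2
  have hc := continuous_cos_legendreF hk2 (Real.pi * m) (ellipticK k)
  have harg : ∀ ψ, Real.pi * (2 * m : ℕ) * legendreF k ψ / (2 * ellipticK k)
      = Real.pi * m * legendreF k ψ / ellipticK k := fun ψ => by push_cast; field_simp
  have hcont : Continuous fun ψ => (legendreDelta k ψ + k * Real.cos ψ) ^ 2 / legendreDelta k ψ *
      Real.cos (Real.pi * (2 * m : ℕ) * legendreF k ψ / (2 * ellipticK k)) :=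
    ((((continuous_legendreDelta k).add (by fun_prop)).pow 2).div (continuous_legendreDelta k)
      fun x => (legendreDelta_pos hk2 x).ne').mul (continuous_cos_legendreF hk2 _ _)
  rw [dnSqCosIntegral_landenUp hk, integral_zero_pi_eq hcont]
  have h1 : ∀ ψ, (legendreDelta k ψ + k * Real.cos ψ) ^ 2 / legendreDelta k ψ *
        Real.cos (Real.pi * (2 * m : ℕ) * legendreF k ψ / (2 * ellipticK k)) +
      (legendreDelta k (Real.pi - ψ) + k * Real.cos (Real.pi - ψ)) ^ 2 /
          legendreDelta k (Real.pi - ψ) *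
        Real.cos (Real.pi * (2 * m : ℕ) * legendreF k (Real.pi - ψ) / (2 * ellipticK k)) =
      4 * (legendreDelta k ψ * Real.cos (Real.pi * m * legendreF k ψ / ellipticK k)) -
      2 * (1 - k ^ 2) *
        ((legendreDelta k ψ)⁻¹ * Real.cos (Real.pi * m * legendreF k ψ / ellipticK k)) := by
    intro ψ
    rw [cos_legendreF_pi_sub hk2, harg, legendreDelta_pi_sub, Real.cos_pi_sub, pow_mul]
    have h2 := legendreDelta_pos hk2 ψ
    have h3 := legendreDelta_sq hk2 ψ
    have h4 := Real.cos_sq' ψ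
    norm_num
    field_simp
    linear_combination
      Real.cos (Real.pi * m * legendreF k ψ / ellipticK k) * (-2 * h3 + 2 * k ^ 2 * h4)
  simp only [h1]
  rw [intervalIntegral.integral_sub, intervalIntegral.integral_const_mul,
    intervalIntegral.integral_const_mul, integral_inv_legendreDelta_mul_cos hk2 hm,
    dnSqCosIntegral]
  · field_simp
    ring
  · exact (((continuous_legendreDelta k).mul hc).const_mul 4).intervalIntegrable _ _
  · exact (((continuous_inv_legendreDelta hk2).mul hc).const_mul _).intervalIntegrable _ _

/-- The part of `dn²` which changes sign under a half period is a multiple of `sn'`, with the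
modulus of Landen's transformation. -/
theorem dnSqCosIntegral_odd_landenUp (hk : k ∈ Ioo (0 : ℝ) 1) {n : ℕ} (hn : Odd n) :
    dnSqCosIntegral n (landenUp k) = 2 * k / (1 + k) * snDerivCosIntegral n k := by
  have h0 := hk.1
  have hk2 := sq_lt_one_of_mem_Ioo hk
  have hcont : Continuous fun ψ => (legendreDelta k ψ + k * Real.cos ψ) ^ 2 / legendreDelta k ψ *
      Real.cos (Real.pi * n * legendreF k ψ / (2 * ellipticK k)) :=
    ((((continuous_legendreDelta k).add (by fun_prop)).pow 2).div (continuous_legendreDelta k)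
      fun x => (legendreDelta_pos hk2 x).ne').mul (continuous_cos_legendreF hk2 _ _)
  rw [dnSqCosIntegral_landenUp hk, integral_zero_pi_eq hcont, snDerivCosIntegral,
    ← intervalIntegral.integral_const_mul, ← intervalIntegral.integral_const_mul]
  refine intervalIntegral.integral_congr fun ψ _ => ?_
  rw [cos_legendreF_pi_sub hk2, legendreDelta_pi_sub, Real.cos_pi_sub, hn.neg_one_pow]
  have h2 := legendreDelta_pos hk2 ψ
  field_simp
  ring

end Landen

/-! ### The limit of modulus one -/

open Filter Topology in
theorem tendsto_iterate_landenUp {k : ℝ} (hk : k ∈ Ioo (0 : ℝ) 1) :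
    Tendsto (fun j => landenUp^[j] k) atTop (𝓝[<] 1) := by
  have hmem : ∀ j, landenUp^[j] k ∈ Ioo (0 : ℝ) 1 := fun j => by
    induction j with
    | zero => exact hk
    | succ j ih => rw [Function.iterate_succ_apply']; exact landenUp_mem ih
  have hstep : ∀ x ∈ Ioo (0 : ℝ) 1, 1 - landenUp x ≤ (1 - x) ^ 2 := by
    intro x hx
    have h1 := Real.sq_sqrt hx.1.le
    have h2 := Real.sqrt_nonneg x
    have h0 := hx.1
    rw [one_sub_landenUp hx.1.le, div_le_iff₀ (by linarith)]
    have h3 : (1 - x) ^ 2 = (1 - Real.sqrt x) ^ 2 * (1 + Real.sqrt x) ^ 2 := by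
      rw [← mul_pow, show (1 - Real.sqrt x) * (1 + Real.sqrt x) = 1 - Real.sqrt x ^ 2 by ring, h1]
    rw [h3, mul_assoc]
    refine le_mul_of_one_le_right (sq_nonneg _) ?_
    nlinarith
  have hle : ∀ j, 1 - landenUp^[j] k ≤ (1 - k) ^ (j + 1) := fun j => by
    have h1 : 0 ≤ 1 - k := by linarith [hk.2]
    have h2 : 1 - k ≤ 1 := by linarith [hk.1]
    induction j with
    | zero => simp
    | succ j ih =>
      rw [Function.iterate_succ_apply']
      calc 1 - landenUp (landenUp^[j] k) ≤ (1 - landenUp^[j] k) ^ 2 := hstep _ (hmem j)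
        _ ≤ ((1 - k) ^ (j + 1)) ^ 2 := by gcongr; linarith [(hmem j).2]
        _ = (1 - k) ^ ((j + 1) * 2) := (pow_mul _ _ _).symm
        _ ≤ (1 - k) ^ (j + 1 + 1) := pow_le_pow_of_le_one h1 h2 (by omega)
  refine tendsto_nhdsWithin_iff.2 ⟨?_, Eventually.of_forall fun j => (hmem j).2⟩
  have h0 : Tendsto (fun j => 1 - (1 - k) ^ (j + 1)) atTop (𝓝 1) := by
    have h := (tendsto_pow_atTop_nhds_zero_of_lt_one (r := 1 - k) (by linarith [hk.2])
      (by linarith [hk.1])).comp (tendsto_add_atTop_nat 1)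
    simpa using h.const_sub 1
  exact tendsto_of_tendsto_of_tendsto_of_le_of_le h0 tendsto_const_nhds
    (fun j => by linarith [hle j]) fun j => (hmem j).2.le

open Filter Topology in
theorem tendsto_ellipticK_complement :
    Tendsto (fun k => ellipticK (Real.sqrt (1 - k ^ 2))) (𝓝[<] 1) (𝓝 (Real.pi / 2)) := by
  have hup : Tendsto (fun k : ℝ => Real.pi / 2 * k⁻¹) (𝓝[<] 1) (𝓝 (Real.pi / 2)) := by
    have : Tendsto (fun k : ℝ => Real.pi / 2 * k⁻¹) (𝓝 1) (𝓝 (Real.pi / 2 * 1⁻¹)) :=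
      (tendsto_inv₀ one_ne_zero).const_mul _
    rw [inv_one, mul_one] at this
    exact this.mono_left nhdsWithin_le_nhds
  have hIoo : ∀ᶠ k : ℝ in 𝓝[<] 1, k ∈ Ioo (0 : ℝ) 1 := Ioo_mem_nhdsLT one_pos
  refine tendsto_of_tendsto_of_tendsto_of_le_of_le' tendsto_const_nhds hup ?_ ?_
  · filter_upwards [hIoo] with k hk
    rw [ellipticK_eq_legendreF]
    exact le_legendreF (sq_lt_one_of_mem_Ioo (sqrt_one_sub_sq_mem hk)) (by positivity)
  · filter_upwards [hIoo] with k hk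
    have hk' := sq_lt_one_of_mem_Ioo (sqrt_one_sub_sq_mem hk)
    have hsq : Real.sqrt (1 - k ^ 2) ^ 2 = 1 - k ^ 2 :=
      Real.sq_sqrt (by linarith [sq_lt_one_of_mem_Ioo hk])
    rw [ellipticK_eq_legendreF, legendreF]
    have h : ∫ θ in (0 : ℝ)..Real.pi / 2, (legendreDelta (Real.sqrt (1 - k ^ 2)) θ)⁻¹ ≤
        ∫ _ in (0 : ℝ)..Real.pi / 2, k⁻¹ := by
      refine intervalIntegral.integral_mono_on (by positivity)
        ((continuous_inv_legendreDelta hk').intervalIntegrable _ _) (by simp) fun x _ => ?_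
      refine inv_anti₀ hk.1 (Real.le_sqrt_of_sq_le ?_)
      have := sq_mul_sin_sq_le (Real.sqrt (1 - k ^ 2)) x
      rw [hsq] at this
      rw [hsq]
      linarith
    simpa using h

theorem cos_le_legendreDelta {k : ℝ} (hk : k ^ 2 ≤ 1) (θ : ℝ) :
    Real.cos θ ≤ legendreDelta k θ := by
  refine Real.le_sqrt_of_sq_le ?_
  rw [Real.cos_sq']
  nlinarith [sq_nonneg (Real.sin θ)]

/-- For the modulus `1` the elliptic integral is elementary: it is `artanh (sin φ)`. -/
theorem integral_inv_cos {φ : ℝ} (h0 : 0 ≤ φ) (h1 : φ < Real.pi / 2) :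
    ∫ θ in (0 : ℝ)..φ, (Real.cos θ)⁻¹ =
      (Real.log (1 + Real.sin φ) - Real.log (1 - Real.sin φ)) / 2 := by
  have hcos : ∀ x ∈ uIcc 0 φ, 0 < Real.cos x := fun x hx => by
    rw [uIcc_of_le h0] at hx
    exact Real.cos_pos_of_mem_Ioo ⟨by linarith [hx.1, Real.pi_pos], by linarith [hx.2]⟩
  have hd : ∀ x ∈ uIcc 0 φ, HasDerivAt
      (fun φ => (Real.log (1 + Real.sin φ) - Real.log (1 - Real.sin φ)) / 2)
      (Real.cos x)⁻¹ x := by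
    intro x hx
    have hc := hcos x hx
    have hcs := Real.cos_sq' x
    have hp : 0 < 1 - Real.sin x ^ 2 := by rw [← hcs]; positivity
    have ha : 0 < 1 + Real.sin x := by nlinarith [Real.neg_one_le_sin x, Real.sin_le_one x]
    have hb : 0 < 1 - Real.sin x := by nlinarith [Real.neg_one_le_sin x, Real.sin_le_one x]
    have h := ((((Real.hasDerivAt_sin x).const_add 1).log ha.ne').sub
      (((Real.hasDerivAt_sin x).const_sub 1).log hb.ne')).div_const 2
    refine h.congr_deriv ?_
    field_simp
    linear_combination 2 * hcs
  rw [intervalIntegral.integral_eq_sub_of_hasDerivAt hd]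
  · simp
  · exact ContinuousOn.intervalIntegrable
      (Real.continuous_cos.continuousOn.inv₀ fun x hx => (hcos x hx).ne')

open Filter Topology in
theorem tendsto_legendreF_one {φ : ℝ} (h0 : 0 ≤ φ) (h1 : φ < Real.pi / 2) :
    Tendsto (fun k => legendreF k φ) (𝓝[<] 1)
      (𝓝 ((Real.log (1 + Real.sin φ) - Real.log (1 - Real.sin φ)) / 2)) := by
  have hIoo : ∀ᶠ k : ℝ in 𝓝[<] 1, k ∈ Ioo (0 : ℝ) 1 := Ioo_mem_nhdsLT one_pos
  have hcos : ∀ x ∈ uIoc 0 φ, 0 < Real.cos x := fun x hx => by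
    rw [uIoc_of_le h0] at hx
    exact Real.cos_pos_of_mem_Ioo ⟨by linarith [hx.1, Real.pi_pos], by linarith [hx.2]⟩
  rw [← integral_inv_cos h0 h1]
  unfold legendreF
  refine intervalIntegral.tendsto_integral_filter_of_dominated_convergence
    (fun θ => (Real.cos θ)⁻¹) ?_ ?_ ?_ ?_
  · filter_upwards [hIoo] with k hk
    exact (continuous_inv_legendreDelta (sq_lt_one_of_mem_Ioo hk)).aestronglyMeasurable
  · filter_upwards [hIoo] with k hk
    refine Eventually.of_forall fun x hx => ?_
    rw [Real.norm_of_nonneg (inv_nonneg.2 (legendreDelta_pos (sq_lt_one_of_mem_Ioo hk) x).le)]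
    exact inv_anti₀ (hcos x hx) (cos_le_legendreDelta (sq_lt_one_of_mem_Ioo hk).le x)
  · refine ContinuousOn.intervalIntegrable
      (Real.continuous_cos.continuousOn.inv₀ fun x hx => ?_)
    rw [uIcc_of_le h0] at hx
    exact (Real.cos_pos_of_mem_Ioo ⟨by linarith [hx.1, Real.pi_pos], by linarith [hx.2]⟩).ne'
  · refine Eventually.of_forall fun x hx => ?_
    have hlim : Tendsto (fun k => legendreDelta k x) (𝓝[<] 1) (𝓝 (legendreDelta 1 x)) := by
      refine Tendsto.mono_left ?_ nhdsWithin_le_nhds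
      have : Continuous fun k => legendreDelta k x := by unfold legendreDelta; fun_prop
      exact this.tendsto 1
    have h2 : legendreDelta 1 x = Real.cos x := by
      rw [legendreDelta, one_pow, one_mul, ← Real.cos_sq', Real.sqrt_sq (hcos x hx).le]
    rw [h2] at hlim
    exact hlim.inv₀ (hcos x hx).ne'

/-- The cosine transform of `sech²`, after the substitution `t = tanh u`; it is a Beta integral. -/
theorem integral_cos_log {ω : ℝ} (hω : ω ≠ 0) :
    ∫ t in (0 : ℝ)..1, Real.cos (ω * (Real.log (1 + t) - Real.log (1 - t))) =
      Real.pi * ω / Real.sinh (Real.pi * ω) := by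
  set u : ℂ := (ω : ℂ) * Complex.I with hu
  have hu0 : u ≠ 0 := mul_ne_zero (Complex.ofReal_ne_zero.2 hω) Complex.I_ne_zero
  have hre : u.re = 0 := by simp [hu]
  -- the value of the Beta integral, by Euler's reflection formula
  have hB : Complex.betaIntegral (1 + u) (1 - u) =
      ((Real.pi * ω / Real.sinh (Real.pi * ω) : ℝ) : ℂ) := by
    have h1 := Complex.Gamma_mul_Gamma_eq_betaIntegral (s := 1 + u) (t := 1 - u)
      (by simp [hre]) (by simp [hre])
    rw [show 1 + u + (1 - u) = 1 + 1 by ring, Complex.Gamma_add_one 1 one_ne_zero,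
      Complex.Gamma_one, mul_one, one_mul, add_comm 1 u, Complex.Gamma_add_one u hu0, mul_assoc,
      Complex.Gamma_mul_Gamma_one_sub, add_comm u 1] at h1
    rw [← h1, hu, ← mul_assoc, Complex.sin_mul_I]
    push_cast
    have hI := Complex.I_ne_zero
    by_cases hs : Complex.sinh (Real.pi * ω) = 0
    · simp [hs]
    · field_simp
  set g : ℝ → ℝ := fun x => Real.cos (ω * (Real.log x - Real.log (1 - x))) with hg
  have hcongr : ∀ x ∈ Ioo (0 : ℝ) 1,
      ((x : ℂ) ^ (1 + u - 1) * (1 - (x : ℂ)) ^ (1 - u - 1)).re = g x := by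
    intro x hx
    have hx1 : (0 : ℝ) < 1 - x := by linarith [hx.2]
    have e1 : (1 - (x : ℂ)) = ((1 - x : ℝ) : ℂ) := by push_cast; ring
    rw [e1, Complex.cpow_def_of_ne_zero (Complex.ofReal_ne_zero.2 hx.1.ne'),
      Complex.cpow_def_of_ne_zero (Complex.ofReal_ne_zero.2 hx1.ne'), ← Complex.exp_add,
      ← Complex.ofReal_log hx.1.le, ← Complex.ofReal_log hx1.le]
    have e2 : (Real.log x : ℂ) * (1 + u - 1) + (Real.log (1 - x) : ℂ) * (1 - u - 1)
        = ((ω * (Real.log x - Real.log (1 - x)) : ℝ) : ℂ) * Complex.I := by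
      rw [hu]; push_cast; ring
    rw [e2, Complex.exp_ofReal_mul_I_re]
  have hint := Complex.betaIntegral_convergent (u := 1 + u) (v := 1 - u) (by simp [hre])
    (by simp [hre])
  have hbeta : ∫ x in (0 : ℝ)..1, g x = Real.pi * ω / Real.sinh (Real.pi * ω) := by
    have h1 := Complex.reCLM.intervalIntegral_comp_comm hint
    have h2 := congrArg Complex.re hB
    rw [Complex.betaIntegral] at h2
    simp only [Complex.reCLM_apply] at h1
    rw [Complex.ofReal_re] at h2
    rw [← h2, ← h1, intervalIntegral.integral_of_le zero_le_one,
      intervalIntegral.integral_of_le zero_le_one, integral_Ioc_eq_integral_Ioo,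
      integral_Ioc_eq_integral_Ioo]
    exact setIntegral_congr_fun measurableSet_Ioo fun x hx => (hcongr x hx).symm
  have hgint : ∀ a b, IntervalIntegrable g volume a b := by
    intro a b
    refine (intervalIntegrable_const (c := (1 : ℝ))).mono_fun ?_ ?_
    · exact (Measurable.aestronglyMeasurable (by fun_prop))
    · exact Filter.Eventually.of_forall fun x => by
        simpa using Real.abs_cos_le_one _
  have hsymm : ∫ x in (0 : ℝ)..1 / 2, g x = ∫ x in (1 / 2 : ℝ)..1, g x := by
    have h := intervalIntegral.integral_comp_sub_left (a := 0) (b := 1 / 2) g 1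
    rw [sub_zero, show (1 : ℝ) - 1 / 2 = 1 / 2 by norm_num] at h
    rw [← h]
    refine intervalIntegral.integral_congr fun x _ => ?_
    simp only [hg]
    rw [← Real.cos_neg]
    congr 1
    rw [sub_sub_cancel]
    ring
  have hhalf : ∫ x in (0 : ℝ)..1, g x = 2 * ∫ x in (1 / 2 : ℝ)..1, g x := by
    rw [← intervalIntegral.integral_add_adjacent_intervals (hgint 0 (1 / 2)) (hgint (1 / 2) 1),
      hsymm]
    ring
  have hscale := intervalIntegral.smul_integral_comp_mul_add (a := 0) (b := 1) g (1 / 2) (1 / 2)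
  rw [mul_zero, zero_add, mul_one, add_halves, smul_eq_mul] at hscale
  rw [← hbeta, hhalf, ← hscale, ← mul_assoc, mul_one_div_cancel two_ne_zero, one_mul,
    intervalIntegral.integral_of_le zero_le_one, intervalIntegral.integral_of_le zero_le_one,
    integral_Ioc_eq_integral_Ioo, integral_Ioc_eq_integral_Ioo]
  refine setIntegral_congr_fun measurableSet_Ioo fun t ht => ?_
  have ha : 0 < 1 + t := by linarith [ht.1]
  have hb : 0 < 1 - t := by linarith [ht.2]
  simp only [hg]
  rw [show 1 / 2 * t + 1 / 2 = (1 + t) / 2 by ring, show 1 - (1 + t) / 2 = (1 - t) / 2 by ring,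
    Real.log_div ha.ne' two_ne_zero, Real.log_div hb.ne' two_ne_zero]
  congr 2
  ring

/-! ### The cosine integrals of `dn²` and `sn'` -/

/-- Subtracting `(1 - k²) ∫ cos(π n u / K) du = 0` leaves the integral of `k² cn²`, whose integrand
in the variable `φ` is bounded by `1`, uniformly in the modulus. -/
theorem dnSqCosIntegral_eq {k : ℝ} (hk : k ^ 2 < 1) {n : ℕ} (hn : n ≠ 0) :
    dnSqCosIntegral n k = ∫ φ in (0 : ℝ)..Real.pi / 2,
      k ^ 2 * Real.cos φ ^ 2 / legendreDelta k φ *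
        Real.cos (Real.pi * n * legendreF k φ / ellipticK k) := by
  have hc := continuous_cos_legendreF hk (Real.pi * n) (ellipticK k)
  have h : ∀ φ, k ^ 2 * Real.cos φ ^ 2 / legendreDelta k φ *
      Real.cos (Real.pi * n * legendreF k φ / ellipticK k) =
      legendreDelta k φ * Real.cos (Real.pi * n * legendreF k φ / ellipticK k) -
      (1 - k ^ 2) * ((legendreDelta k φ)⁻¹ *
        Real.cos (Real.pi * n * legendreF k φ / ellipticK k)) := fun φ => by
    have h2 := legendreDelta_pos hk φ
    have h3 := legendreDelta_sq hk φ
    have h4 := Real.cos_sq' φ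
    field_simp
    linear_combination
      Real.cos (Real.pi * n * legendreF k φ / ellipticK k) * (k ^ 2 * h4 - h3)
  simp only [h]
  rw [intervalIntegral.integral_sub, intervalIntegral.integral_const_mul,
    integral_inv_legendreDelta_mul_cos hk hn, mul_zero, sub_zero, dnSqCosIntegral]
  · exact ((continuous_legendreDelta k).mul hc).intervalIntegrable _ _
  · exact (((continuous_inv_legendreDelta hk).mul hc).const_mul _).intervalIntegrable _ _

open Filter Topology in
/-- In the limit of modulus one, `k² cn²` becomes `sech²` and `K'` becomes `π / 2`. -/
theorem tendsto_integral_modulus_one {ω : ℝ} (hω : ω ≠ 0) :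
    Tendsto (fun k => ∫ φ in (0 : ℝ)..Real.pi / 2, k ^ 2 * Real.cos φ ^ 2 / legendreDelta k φ *
        Real.cos (Real.pi * ω * legendreF k φ / ellipticK (Real.sqrt (1 - k ^ 2)))) (𝓝[<] 1)
      (𝓝 (Real.pi * ω / Real.sinh (Real.pi * ω))) := by
  have hIoo : ∀ᶠ k : ℝ in 𝓝[<] 1, k ∈ Ioo (0 : ℝ) 1 := Ioo_mem_nhdsLT one_pos
  have hpi : (0 : ℝ) ≤ Real.pi / 2 := by positivity
  -- the substitution `t = sin φ` in the cosine transform of `sech²`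
  have hval : ∫ φ in (0 : ℝ)..Real.pi / 2,
      Real.cos (ω * (Real.log (1 + Real.sin φ) - Real.log (1 - Real.sin φ))) * Real.cos φ =
      Real.pi * ω / Real.sinh (Real.pi * ω) := by
    have h := intervalIntegral.integral_comp_mul_deriv_of_deriv_nonneg (a := 0) (b := Real.pi / 2)
      (f := Real.sin) (f' := Real.cos)
      (g := fun t => Real.cos (ω * (Real.log (1 + t) - Real.log (1 - t))))
      Real.continuous_sin.continuousOn (fun x _ => Real.hasDerivAt_sin x)
      (fun x hx => by
        rw [min_eq_left hpi, max_eq_right hpi] at hx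
        exact Real.cos_nonneg_of_mem_Icc ⟨by linarith [hx.1], hx.2.le⟩)
    rw [Real.sin_zero, Real.sin_pi_div_two, integral_cos_log hω] at h
    exact h
  rw [← hval]
  refine intervalIntegral.tendsto_integral_filter_of_dominated_convergence (fun _ => 1) ?_ ?_
    (by simp) ?_
  · filter_upwards [hIoo] with k hk
    have hk2 := sq_lt_one_of_mem_Ioo hk
    refine Continuous.aestronglyMeasurable ?_
    exact (Continuous.div (by fun_prop) (continuous_legendreDelta k)
      fun x => (legendreDelta_pos hk2 x).ne').mul (continuous_cos_legendreF hk2 _ _)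
  · filter_upwards [hIoo] with k hk
    have hk2 := sq_lt_one_of_mem_Ioo hk
    refine Eventually.of_forall fun x hx => ?_
    rw [uIoc_of_le hpi] at hx
    have hc : 0 ≤ Real.cos x := Real.cos_nonneg_of_mem_Icc ⟨by linarith [hx.1], hx.2⟩
    have hd := legendreDelta_pos hk2 x
    rw [norm_mul, Real.norm_of_nonneg (by positivity)]
    refine mul_le_one₀ ?_ (norm_nonneg _) (Real.abs_cos_le_one _)
    rw [div_le_one hd]
    calc k ^ 2 * Real.cos x ^ 2 ≤ 1 * Real.cos x ^ 2 := by gcongr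
      _ = Real.cos x * Real.cos x := by ring
      _ ≤ 1 * Real.cos x := by gcongr; exact Real.cos_le_one x
      _ ≤ legendreDelta k x := by rw [one_mul]; exact cos_le_legendreDelta hk2.le x
  · have hne : ∀ᵐ x : ℝ, x ≠ Real.pi / 2 := compl_mem_ae_iff.2 (measure_singleton _)
    filter_upwards [hne] with x hxne hx
    rw [uIoc_of_le hpi] at hx
    have hx2 : x < Real.pi / 2 := lt_of_le_of_ne hx.2 hxne
    have hc : 0 < Real.cos x := Real.cos_pos_of_mem_Ioo ⟨by linarith [hx.1], hx2⟩
    have hid : Tendsto (fun k : ℝ => k) (𝓝[<] 1) (𝓝 1) :=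
      tendsto_id.mono_left nhdsWithin_le_nhds
    have hlim : Tendsto (fun k => legendreDelta k x) (𝓝[<] 1) (𝓝 (legendreDelta 1 x)) := by
      have : Continuous fun k => legendreDelta k x := by unfold legendreDelta; fun_prop
      exact (this.tendsto 1).mono_left nhdsWithin_le_nhds
    have h2 : legendreDelta 1 x = Real.cos x := by
      rw [legendreDelta, one_pow, one_mul, ← Real.cos_sq', Real.sqrt_sq hc.le]
    rw [h2] at hlim
    have hF := tendsto_legendreF_one hx.1.le hx2
    have h3 := (((hid.pow 2).mul_const (Real.cos x ^ 2)).div hlim hc.ne').mul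
      ((Real.continuous_cos.tendsto _).comp
        ((hF.const_mul (Real.pi * ω)).div tendsto_ellipticK_complement (by positivity)))
    refine h3.trans (le_of_eq ?_)
    congr 1
    rw [mul_comm]
    have := Real.pi_pos
    congr 1
    · congr 1
      field_simp
    · field_simp

open Filter Topology in
/-- The cosine coefficients of `dn²`: a Landen step leaves `dnSqCosIntegral n k * K'` and `n K' / K`
unchanged if `n` is doubled, and moves the modulus to its limit `1`. -/
theorem dnSqCosIntegral_mul_complement {k : ℝ} (hk : k ∈ Ioo (0 : ℝ) 1) {n : ℕ} (hn : n ≠ 0) :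
    dnSqCosIntegral n k * ellipticK (Real.sqrt (1 - k ^ 2)) =
      Real.pi / 2 * (Real.pi * (n * ellipticK (Real.sqrt (1 - k ^ 2)) / ellipticK k) /
        Real.sinh (Real.pi * (n * ellipticK (Real.sqrt (1 - k ^ 2)) / ellipticK k))) := by
  set ω := n * ellipticK (Real.sqrt (1 - k ^ 2)) / ellipticK k with hω
  have hKpos : ∀ {x : ℝ}, x ∈ Ioo (0 : ℝ) 1 → 0 < ellipticK x := fun hx =>
    ellipticK_pos (sq_lt_one_of_mem_Ioo hx)
  have hω0 : ω ≠ 0 := by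
    have h1 := hKpos hk
    have h2 := hKpos (sqrt_one_sub_sq_mem hk)
    have h3 : (0 : ℝ) < n := Nat.cast_pos.2 (Nat.pos_of_ne_zero hn)
    positivity
  have hinv : ∀ j, landenUp^[j] k ∈ Ioo (0 : ℝ) 1 ∧
      dnSqCosIntegral (2 ^ j * n) (landenUp^[j] k) *
        ellipticK (Real.sqrt (1 - landenUp^[j] k ^ 2)) =
          dnSqCosIntegral n k * ellipticK (Real.sqrt (1 - k ^ 2)) ∧
      ((2 ^ j * n : ℕ) : ℝ) * ellipticK (Real.sqrt (1 - landenUp^[j] k ^ 2)) /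
        ellipticK (landenUp^[j] k) = ω := by
    intro j
    induction j with
    | zero => exact ⟨hk, by simp, by simp [hω]⟩
    | succ j ih =>
      obtain ⟨h1, h2, h3⟩ := ih
      have hx0 := h1.1
      have hK := hKpos h1
      rw [Function.iterate_succ_apply', pow_succ', mul_assoc]
      refine ⟨landenUp_mem h1, ?_, ?_⟩
      · rw [dnSqCosIntegral_two_mul_landenUp h1 (by positivity), ellipticK_complement_landenUp h1,
          ← h2]
        field_simp
      · rw [ellipticK_complement_landenUp h1, ellipticK_landenUp h1, ← h3]
        push_cast
        field_simp
  have hlim := ((tendsto_integral_modulus_one hω0).mul tendsto_ellipticK_complement).comp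
    (tendsto_iterate_landenUp hk)
  rw [mul_comm (Real.pi / 2)]
  refine tendsto_nhds_unique (Tendsto.congr (fun j => ?_) tendsto_const_nhds) hlim
  obtain ⟨h1, h2, h3⟩ := hinv j
  have hK := hKpos h1
  have hK' := hKpos (sqrt_one_sub_sq_mem h1)
  rw [← h2, dnSqCosIntegral_eq (sq_lt_one_of_mem_Ioo h1) (by positivity)]
  simp only [Function.comp_apply]
  congr 1
  refine intervalIntegral.integral_congr fun φ _ => ?_
  congr 2
  rw [← h3]
  field_simp

theorem nome_mem {k : ℝ} (hk : k ∈ Ioo (0 : ℝ) 1) : nome k ∈ Ioo (0 : ℝ) 1 := by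
  refine ⟨Real.exp_pos _, ?_⟩
  have h1 := ellipticK_pos (sq_lt_one_of_mem_Ioo hk)
  have h2 := ellipticK_pos (sq_lt_one_of_mem_Ioo (sqrt_one_sub_sq_mem hk))
  have h3 := Real.pi_pos
  rw [nome, Real.exp_lt_one_iff, neg_mul, neg_div]
  exact neg_neg_of_pos (by positivity)

/-- For odd `n`, the integral of `sn'` at the modulus `k` is the one of `dn²` at the modulus
`landenUp k`, up to a factor. -/
theorem snDerivCosIntegral_eq {k : ℝ} (hk : k ∈ Ioo (0 : ℝ) 1) {n : ℕ} (hn : Odd n) :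
    snDerivCosIntegral n k =
      Real.pi ^ 2 * n / (2 * k * ellipticK k) *
        (Real.sqrt (nome k) ^ n / (1 - nome k ^ n)) := by
  have hk0 := hk.1
  have hn0 : n ≠ 0 := hn.pos.ne'
  have hnpos : (0 : ℝ) < n := Nat.cast_pos.2 hn.pos
  have hK := ellipticK_pos (sq_lt_one_of_mem_Ioo hk)
  have hK' := ellipticK_pos (sq_lt_one_of_mem_Ioo (sqrt_one_sub_sq_mem hk))
  have hq := nome_mem hk
  have h := dnSqCosIntegral_mul_complement (landenUp_mem hk) hn0
  rw [dnSqCosIntegral_odd_landenUp hk hn, ellipticK_complement_landenUp hk,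
    ellipticK_landenUp hk] at h
  set K := ellipticK k
  set K' := ellipticK (Real.sqrt (1 - k ^ 2)) with hK'def
  set x := Real.pi * n * K' / (2 * K) with hx
  have hx0 : 0 < x := by have := Real.pi_pos; positivity
  have harg : Real.pi * (n * ((1 + k) / 2 * K') / ((1 + k) * K)) = x := by
    rw [hx]; field_simp
  rw [harg] at h
  have hsq : Real.sqrt (nome k) ^ n = Real.exp (-x) := by
    rw [nome, Real.sqrt_eq_rpow, ← Real.exp_mul, ← Real.exp_nat_mul]
    congr 1
    rw [hx, ← hK'def, show ellipticK k = K from rfl]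
    field_simp
  have hqn : nome k ^ n = Real.exp (-x) ^ 2 := by
    rw [← hsq, ← pow_mul, mul_comm n 2, pow_mul, Real.sq_sqrt hq.1.le]
  have he : Real.exp x = (Real.exp (-x))⁻¹ := by rw [Real.exp_neg, inv_inv]
  have he1 : Real.exp (-x) < 1 := by rw [Real.exp_lt_one_iff]; linarith
  have he0 := Real.exp_pos (-x)
  rw [hqn, hsq]
  rw [Real.sinh_eq, he] at h
  set e := Real.exp (-x)
  have h1 : 0 < 1 - e ^ 2 := by nlinarith
  have h2 : e⁻¹ - e ≠ 0 := by
    have : e⁻¹ - e = (1 - e ^ 2) / e := by field_simp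
    rw [this]; positivity
  have h3 : x / ((e⁻¹ - e) / 2) = 2 * x * e / (1 - e ^ 2) := by
    rw [show e⁻¹ - e = (1 - e ^ 2) / e by field_simp]; field_simp
  rw [h3, hx] at h
  have h4 : (1 + k) ≠ 0 := by positivity
  field_simp at h ⊢
  linear_combination h

/-- The sine coefficients of `x ↦ sn (2 K x)`. -/
theorem integral_sin_mul_sn {k : ℝ} (hk : k ∈ Ioo (0 : ℝ) 1) (m : ℕ) :
    ∫ x in (0 : ℝ)..1, Real.sin (m * Real.pi * x) * Real.sin (jacobiAm k (2 * ellipticK k * x)) =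
      if Odd m then Real.pi / (k * ellipticK k) * (Real.sqrt (nome k) ^ m / (1 - nome k ^ m))
      else 0 := by
  have hk2 := sq_lt_one_of_mem_Ioo hk
  have hK := ellipticK_pos hk2
  set s : ℝ → ℝ := fun x => Real.sin (jacobiAm k (2 * ellipticK k * x)) with hs
  have hlin : ∀ x, HasDerivAt (fun x => 2 * ellipticK k * x) (2 * ellipticK k) x := fun x => by
    simpa using (hasDerivAt_id x).const_mul (2 * ellipticK k)
  have hamd : ∀ x, HasDerivAt (fun x => jacobiAm k (2 * ellipticK k * x))
      (legendreDelta k (jacobiAm k (2 * ellipticK k * x)) * (2 * ellipticK k)) x := fun x =>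
    (hasDerivAt_jacobiAm hk2 _).comp x (hlin x)
  have hamc : Continuous fun x => jacobiAm k (2 * ellipticK k * x) :=
    (continuous_jacobiAm hk2).comp (by fun_prop)
  have hsc : Continuous s := Real.continuous_sin.comp hamc
  have hh : Continuous fun x => Real.sin (m * Real.pi * x) * s x := by fun_prop
  have hsymm : ∀ x, s (1 - x) = s x := fun x => by
    simp only [hs]
    rw [show 2 * ellipticK k * (1 - x) = 2 * ellipticK k - 2 * ellipticK k * x by ring,
      jacobiAm_two_K_sub hk2, Real.sin_pi_sub]
  have hsin : ∀ x, Real.sin (m * Real.pi * (1 - x)) = -(-1) ^ m * Real.sin (m * Real.pi * x) := by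
    intro x
    rw [mul_sub, mul_one, Real.sin_sub, Real.sin_nat_mul_pi, Real.cos_nat_mul_pi]
    ring
  have hrefl : ∫ x in (1 / 2 : ℝ)..1, Real.sin (m * Real.pi * x) * s x =
      -(-1) ^ m * ∫ x in (0 : ℝ)..1 / 2, Real.sin (m * Real.pi * x) * s x := by
    have h := intervalIntegral.integral_comp_sub_left (a := 0) (b := 1 / 2)
      (fun x => Real.sin (m * Real.pi * x) * s x) 1
    rw [sub_zero, show (1 : ℝ) - 1 / 2 = 1 / 2 by norm_num] at h
    rw [← h, ← intervalIntegral.integral_const_mul]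
    refine intervalIntegral.integral_congr fun x _ => ?_
    simp only [hsymm, hsin]
    ring
  rw [← intervalIntegral.integral_add_adjacent_intervals (hh.intervalIntegrable 0 (1 / 2))
    (hh.intervalIntegrable (1 / 2) 1), hrefl]
  split_ifs with hm
  · have hm0 : (m : ℝ) ≠ 0 := Nat.cast_ne_zero.2 hm.pos.ne'
    have hpi := Real.pi_pos
    rw [hm.neg_one_pow]
    -- integration by parts, and then the substitution `φ = am (2 K x)`
    have hs' : ∀ x, HasDerivAt s (Real.cos (jacobiAm k (2 * ellipticK k * x)) *
        (legendreDelta k (jacobiAm k (2 * ellipticK k * x)) * (2 * ellipticK k))) x := fun x =>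
      (Real.hasDerivAt_sin _).comp x (hamd x)
    have hcosd : ∀ x, HasDerivAt (fun x => -(Real.cos (m * Real.pi * x) / (m * Real.pi)))
        (Real.sin (m * Real.pi * x)) x := fun x => by
      have h1 : HasDerivAt (fun x : ℝ => m * Real.pi * x) (m * Real.pi) x := by
        simpa using (hasDerivAt_id x).const_mul (m * Real.pi)
      refine (((Real.hasDerivAt_cos _).comp x h1).div_const _).neg.congr_deriv ?_
      field_simp
    have hΔ : Continuous fun x => legendreDelta k (jacobiAm k (2 * ellipticK k * x)) :=
      (continuous_legendreDelta k).comp hamc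
    have hparts := intervalIntegral.integral_mul_deriv_eq_deriv_mul (a := 0) (b := 1 / 2)
      (fun x _ => hs' x) (fun x _ => hcosd x)
      (Continuous.intervalIntegrable (by fun_prop) _ _)
      (Continuous.intervalIntegrable (by fun_prop) _ _)
    have hs0 : s 0 = 0 := by simp [hs, jacobiAm_zero hk2]
    have hcos : Real.cos (m * Real.pi * (1 / 2)) = 0 := by
      obtain ⟨j, rfl⟩ := hm
      push_cast
      rw [show (2 * (j : ℝ) + 1) * Real.pi * (1 / 2) = j * Real.pi + Real.pi / 2 by ring,
        Real.cos_add_pi_div_two, Real.sin_nat_mul_pi, neg_zero]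
    rw [hs0, hcos] at hparts
    have hamhalf : jacobiAm k (2 * ellipticK k * (1 / 2)) = Real.pi / 2 := by
      rw [jacobiAm_eq_iff hk2, ← ellipticK_eq_legendreF]; ring
    have hsub := intervalIntegral.integral_comp_mul_deriv (a := 0) (b := 1 / 2)
      (fun x _ => hamd x) (Continuous.continuousOn (by fun_prop))
      (Real.continuous_cos.mul (continuous_cos_legendreF hk2 (Real.pi * m) (2 * ellipticK k)))
    rw [hamhalf, mul_zero, jacobiAm_zero hk2] at hsub
    have hI : ∫ x in (0 : ℝ)..1 / 2, Real.cos (jacobiAm k (2 * ellipticK k * x)) *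
        (legendreDelta k (jacobiAm k (2 * ellipticK k * x)) * (2 * ellipticK k)) *
        -(Real.cos (m * Real.pi * x) / (m * Real.pi)) =
        -(1 / (m * Real.pi)) * snDerivCosIntegral m k := by
      rw [snDerivCosIntegral]
      refine Eq.trans ?_ (congrArg _ hsub)
      rw [← intervalIntegral.integral_const_mul]
      refine intervalIntegral.integral_congr fun x _ => ?_
      simp only [Function.comp_apply, Pi.mul_apply, legendreF_jacobiAm hk2]
      rw [show Real.pi * m * (2 * ellipticK k * x) / (2 * ellipticK k) = m * Real.pi * x by
        field_simp]
      field_simp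
    rw [hI, snDerivCosIntegral_eq hk hm] at hparts
    have hcomm : ∀ x, Real.sin (m * Real.pi * x) * s x = s x * Real.sin (m * Real.pi * x) :=
      fun x => mul_comm _ _
    simp only [hcomm, hparts]
    have hk0 := hk.1
    field_simp
    ring
  · rw [(Nat.not_odd_iff_even.1 hm).neg_one_pow]
    ring

/-! ### Sine coefficients -/

theorem integral_cos_int_mul_pi {j : ℤ} (hj : j ≠ 0) :
    ∫ x in (0 : ℝ)..1, Real.cos (j * Real.pi * x) = 0 := by
  have h0 : (j : ℝ) * Real.pi ≠ 0 := mul_ne_zero (Int.cast_ne_zero.2 hj) Real.pi_ne_zero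
  rw [intervalIntegral.integral_comp_mul_left _ h0, integral_cos, mul_one, mul_zero,
    Real.sin_int_mul_pi]
  simp

theorem integral_sin_mul_sin (a b : ℕ+) :
    ∫ x in (0 : ℝ)..1, Real.sin ((a : ℕ) * Real.pi * x) * Real.sin ((b : ℕ) * Real.pi * x) =
      if b = a then 1 / 2 else 0 := by
  have ha := a.pos
  have hb := b.pos
  have h : ∀ x : ℝ, Real.sin ((a : ℕ) * Real.pi * x) * Real.sin ((b : ℕ) * Real.pi * x) =
      (1 / 2) * (Real.cos (((a : ℤ) - (b : ℤ) : ℤ) * Real.pi * x) -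
        Real.cos (((a : ℤ) + (b : ℤ) : ℤ) * Real.pi * x)) := by
    intro x
    have h1 := Real.cos_sub ((a : ℕ) * Real.pi * x) ((b : ℕ) * Real.pi * x)
    have h2 := Real.cos_add ((a : ℕ) * Real.pi * x) ((b : ℕ) * Real.pi * x)
    push_cast
    rw [sub_mul, sub_mul, add_mul, add_mul, h1, h2]
    ring
  simp only [h]
  rw [intervalIntegral.integral_const_mul, intervalIntegral.integral_sub
    (Continuous.intervalIntegrable (by fun_prop) _ _)
    (Continuous.intervalIntegrable (by fun_prop) _ _),
    integral_cos_int_mul_pi (j := (a : ℤ) + (b : ℤ)) (by omega)]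
  split_ifs with hab
  · simp [hab]
  · have hne : (a : ℤ) - (b : ℤ) ≠ 0 := fun h0 => hab (PNat.coe_injective (by omega))
    rw [integral_cos_int_mul_pi hne]
    simp

theorem sineCoeff_ofReal {𝕜 : Type*} [RCLike 𝕜] (g : ℝ → ℝ) (m : ℕ+) :
    sineCoeff (fun x => (g x : 𝕜)) m =
      ((Real.sqrt 2 * ∫ x in (0 : ℝ)..1, Real.sin ((m : ℕ) * Real.pi * x) * g x : ℝ) : 𝕜) := by
  rw [sineCoeff, intervalIntegral.integral_of_le zero_le_one, integral_Ioc_eq_integral_Ioo,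
    RCLike.real_smul_eq_coe_mul, RCLike.ofReal_mul, ← integral_ofReal]
  simp only [RCLike.real_smul_eq_coe_mul, RCLike.ofReal_mul]

theorem integral_sin_mul_sineSeries {c : ℕ → ℝ} (hc : Summable fun l => |c l|) (N : ℕ → ℕ+)
    (m : ℕ+) :
    ∫ x in (0 : ℝ)..1, Real.sin ((m : ℕ) * Real.pi * x) *
      ∑' l, c l * Real.sin ((N l : ℕ) * Real.pi * x) =
      ∑' l, if N l = m then c l / 2 else 0 := by
  have hs : ∀ x : ℝ, Summable fun l => c l * Real.sin ((N l : ℕ) * Real.pi * x) := fun x =>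
    Summable.of_norm_bounded hc fun l => by
      rw [Real.norm_eq_abs, abs_mul]
      exact mul_le_of_le_one_right (abs_nonneg _) (Real.abs_sin_le_one _)
  have h := intervalIntegral.hasSum_integral_of_dominated_convergence (μ := volume) (a := 0)
    (b := 1) (F := fun l x => Real.sin ((m : ℕ) * Real.pi * x) *
      (c l * Real.sin ((N l : ℕ) * Real.pi * x)))
    (f := fun x => Real.sin ((m : ℕ) * Real.pi * x) *
      ∑' l, c l * Real.sin ((N l : ℕ) * Real.pi * x)) (fun l _ => |c l|)
    (fun l => Continuous.aestronglyMeasurable (by fun_prop))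
    (fun l => Filter.Eventually.of_forall fun x _ => by
      rw [Real.norm_eq_abs, abs_mul, abs_mul]
      exact (mul_le_of_le_one_left (by positivity) (Real.abs_sin_le_one _)).trans
        (mul_le_of_le_one_right (abs_nonneg _) (Real.abs_sin_le_one _)))
    (Filter.Eventually.of_forall fun x _ => hc)
    (by simp)
    (Filter.Eventually.of_forall fun x _ => (hs x).hasSum.mul_left _)
  rw [← h.tsum_eq]
  refine tsum_congr fun l => ?_
  have h1 : ∀ x : ℝ, Real.sin ((m : ℕ) * Real.pi * x) *
      (c l * Real.sin ((N l : ℕ) * Real.pi * x)) = c l * (Real.sin ((m : ℕ) * Real.pi * x) *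
        Real.sin ((N l : ℕ) * Real.pi * x)) := fun x => by ring
  simp only [h1]
  rw [intervalIntegral.integral_const_mul, integral_sin_mul_sin]
  split_ifs <;> ring

theorem continuous_sineSeries {c : ℕ → ℝ} (hc : Summable fun l => |c l|) (N : ℕ → ℕ+) :
    Continuous fun x : ℝ => ∑' l, c l * Real.sin ((N l : ℕ) * Real.pi * x) := by
  refine continuous_tsum (fun l => by fun_prop) hc fun l x => ?_
  rw [Real.norm_eq_abs, abs_mul]
  exact mul_le_of_le_one_right (abs_nonneg _) (Real.abs_sin_le_one _)

theorem Continuous.memLp_unitMeasure {𝕜 : Type*} [RCLike 𝕜] {f : ℝ → 𝕜} (hf : Continuous f) :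
    MemLp f 2 unitMeasure := by
  obtain ⟨C, hC⟩ := isCompact_Icc.exists_bound_of_continuousOn (s := Icc (0 : ℝ) 1) hf.continuousOn
  refine MemLp.of_bound hf.aestronglyMeasurable C ?_
  filter_upwards [ae_restrict_mem measurableSet_Ioo] with x hx using hC x (Ioo_subset_Icc_self hx)

theorem ae_eq_of_sineCoeff_eq {𝕜 : Type*} [RCLike 𝕜] {f g : ℝ → 𝕜} (hf : MemLp f 2 unitMeasure)
    (hg : MemLp g 2 unitMeasure) (h : ∀ n, sineCoeff f n = sineCoeff g n) :
    f =ᵐ[unitMeasure] g := by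
  have hsub : ∀ n, sineCoeff (f - g) n = 0 := fun n => by
    have h1 := sineCoeff_add ((hf.sub hg).toLp (f - g)) (hg.toLp g) n
    rw [← MemLp.toLp_add, sineCoeff_congr (MemLp.coeFn_toLp _), sub_add_cancel,
      sineCoeff_congr (MemLp.coeFn_toLp _), sineCoeff_congr (MemLp.coeFn_toLp _), h n] at h1
    exact left_eq_add.1 (h1.trans (add_comm _ _))
  filter_upwards [ae_zero_of_sineCoeff_eq_zero (hf.sub hg) hsub] with x hx
  exact sub_eq_zero.1 hx

theorem eqOn_of_sineCoeff_eq {f g : ℝ → ℝ} (hf : Continuous f) (hg : Continuous g)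
    (h : ∀ n, sineCoeff f n = sineCoeff g n) : EqOn f g (Icc 0 1) := by
  have h1 := ae_eq_of_sineCoeff_eq hf.memLp_unitMeasure hg.memLp_unitMeasure h
  have h2 : EqOn f g (Ioo 0 1) :=
    Measure.eqOn_open_of_ae_eq h1 isOpen_Ioo hf.continuousOn hg.continuousOn
  rw [← closure_Ioo (zero_ne_one' ℝ)]
  exact h2.closure hf hg

/-! ### The sine series of `sn` -/

/-- The odd positive integer `2 l + 1`. -/
def oddPNat (l : ℕ) : ℕ+ := ⟨2 * l + 1, Nat.succ_pos _⟩

theorem coe_oddPNat (l : ℕ) : (oddPNat l : ℕ) = 2 * l + 1 := rfl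

theorem oddPNat_injective : Function.Injective oddPNat := fun a b h => by
  have := congrArg (fun n : ℕ+ => (n : ℕ)) h
  simp only [coe_oddPNat] at this
  omega

/-- The `(2 l + 1)`-st sine coefficient of `x ↦ sn (2 K x)`. -/
noncomputable def snCoeff (k : ℝ) (l : ℕ) : ℝ :=
  2 * Real.pi / (k * ellipticK k) *
    (Real.sqrt (nome k) ^ (2 * l + 1) / (1 - nome k ^ (2 * l + 1)))

theorem summable_abs_snCoeff {k : ℝ} (hk : k ∈ Ioo (0 : ℝ) 1) :
    Summable fun l => |snCoeff k l| := by
  have hq := nome_mem hk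
  have hsq : nome k = Real.sqrt (nome k) ^ 2 := (Real.sq_sqrt hq.1.le).symm
  have hgeo : Summable fun l : ℕ => (1 - nome k)⁻¹ * Real.sqrt (nome k) * nome k ^ l :=
    (summable_geometric_of_lt_one hq.1.le hq.2).mul_left _
  have h : Summable fun l : ℕ =>
      Real.sqrt (nome k) ^ (2 * l + 1) / (1 - nome k ^ (2 * l + 1)) := by
    have hlt : ∀ l : ℕ, nome k ^ (2 * l + 1) ≤ nome k := fun l =>
      pow_le_of_le_one hq.1.le hq.2.le (Nat.succ_ne_zero _)
    refine Summable.of_nonneg_of_le (fun l => div_nonneg (by positivity) ?_) (fun l => ?_) hgeo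
    · linarith [hlt l, hq.2]
    · have h1 : 0 < 1 - nome k := by linarith [hq.2]
      rw [pow_succ, pow_mul, ← hsq, div_eq_inv_mul, mul_assoc, mul_comm (Real.sqrt _)]
      gcongr
      · have := hq.1
        positivity
      · exact hlt l
  exact (h.mul_left _).abs

/-- The sine series of `sn`, at every real point. -/
theorem sn_eq_tsum {k : ℝ} (hk : k ∈ Ioo (0 : ℝ) 1) (x : ℝ) :
    jacobiSn (2 * ellipticK k * x) k =
      ∑' l, snCoeff k l * Real.sin ((oddPNat l : ℕ) * Real.pi * x) := by
  have hk2 := sq_lt_one_of_mem_Ioo hk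
  have hK := ellipticK_pos hk2
  rw [jacobiSn_eq hk2]
  set s : ℝ → ℝ := fun x => Real.sin (jacobiAm k (2 * ellipticK k * x)) with hs
  set t : ℝ → ℝ := fun x => ∑' l, snCoeff k l * Real.sin ((oddPNat l : ℕ) * Real.pi * x) with ht
  have hsc : Continuous s :=
    Real.continuous_sin.comp ((continuous_jacobiAm hk2).comp (by fun_prop))
  have htc : Continuous t := continuous_sineSeries (summable_abs_snCoeff hk) oddPNat
  have heq : EqOn s t (Icc 0 1) := by
    refine eqOn_of_sineCoeff_eq hsc htc fun m => ?_
    have h1 := sineCoeff_ofReal (𝕜 := ℝ) s m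
    have h2 := sineCoeff_ofReal (𝕜 := ℝ) t m
    simp only [RCLike.ofReal_real_eq_id, id] at h1 h2
    change sineCoeff s m = _ at h1
    change sineCoeff t m = _ at h2
    rw [h1, h2, integral_sin_mul_sn hk, integral_sin_mul_sineSeries (summable_abs_snCoeff hk)]
    congr 1
    split_ifs with hm
    · obtain ⟨j, hj⟩ := hm
      have hmj : oddPNat j = m := PNat.coe_injective (by rw [coe_oddPNat, hj])
      rw [tsum_eq_single j fun l hl => if_neg fun h => hl (oddPNat_injective (h.trans hmj.symm)),
        if_pos hmj, snCoeff, hj]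
      ring
    · refine ((tsum_congr fun l => if_neg fun h => hm ?_).trans tsum_zero).symm
      rw [← h, coe_oddPNat]
      exact ⟨l, rfl⟩
  -- both sides change sign under a shift by `1`, so that the unit interval determines them
  have hsa : Function.Antiperiodic s 1 := fun x => by
    simp only [hs]
    rw [mul_add, mul_one]
    exact sin_jacobiAm_antiperiodic hk2 _
  have hta : Function.Antiperiodic t 1 := fun x => by
    simp only [ht]
    rw [← tsum_neg]
    refine tsum_congr fun l => ?_
    rw [mul_add, mul_one, Real.sin_add_nat_mul_pi, coe_oddPNat, Odd.neg_one_pow ⟨l, rfl⟩]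
    ring
  have hsub : Function.Periodic (fun x => |s x - t x|) 1 := fun x => by
    simp only
    rw [hsa x, hta x, ← neg_sub', abs_neg]
  have hfr := hsub.sub_int_mul_eq (x := x) ⌊x⌋
  rw [mul_one] at hfr
  change |s (Int.fract x) - t (Int.fract x)| = _ at hfr
  rw [heq ⟨Int.fract_nonneg x, (Int.fract_lt_one x).le⟩, sub_self, abs_zero] at hfr
  exact sub_eq_zero.1 (abs_eq_zero.1 hfr.symm)

/-- The sine coefficients of the eigenfunctions. At most one `l` contributes to the sum. -/
theorem sineCoeff_gpFun {𝕜 : Type*} [RCLike 𝕜] (n : ℕ+) {k : ℝ} (hk : k ∈ Ioo (0 : ℝ) 1)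
    (m : ℕ+) :
    sineCoeff (fun x => ((gpFun n k x : ℝ) : 𝕜)) m =
      ((4 * Real.pi * (n : ℕ) * ∑' l, if oddPNat l * n = m then
        Real.sqrt (nome k) ^ (2 * l + 1) / (1 - nome k ^ (2 * l + 1)) else 0 : ℝ) : 𝕜) := by
  have hk0 := hk.1
  have hK := ellipticK_pos (sq_lt_one_of_mem_Ioo hk)
  rw [sineCoeff_ofReal]
  congr 1
  set c : ℝ := 2 ^ (3 / 2 : ℝ) * (n : ℕ) * k * ellipticK k with hc
  have hgp : ∀ x, Real.sin ((m : ℕ) * Real.pi * x) * gpFun n k x =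
      c * (Real.sin ((m : ℕ) * Real.pi * x) *
        ∑' l, snCoeff k l * Real.sin ((oddPNat l * n : ℕ+) * Real.pi * x)) := fun x => by
    rw [gpFun, show 2 * ellipticK k * (n : ℕ) * x = 2 * ellipticK k * ((n : ℕ) * x) by ring,
      sn_eq_tsum hk, ← hc]
    have : ∀ l, (oddPNat l : ℕ) * Real.pi * ((n : ℕ) * x) =
        ((oddPNat l * n : ℕ+) : ℕ) * Real.pi * x := fun l => by push_cast; ring
    simp only [this]
    ring
  simp only [hgp]
  rw [intervalIntegral.integral_const_mul,
    integral_sin_mul_sineSeries (summable_abs_snCoeff hk) fun l => oddPNat l * n, ← tsum_mul_left,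
    ← tsum_mul_left, ← tsum_mul_left]
  refine tsum_congr fun l => ?_
  have h2 : Real.sqrt 2 * (2 : ℝ) ^ (3 / 2 : ℝ) = 4 := by
    rw [Real.sqrt_eq_rpow, ← Real.rpow_add two_pos]
    norm_num
  split_ifs with h
  · rw [hc, snCoeff]
    have : Real.sqrt 2 * (2 ^ (3 / 2 : ℝ) * (n : ℕ) * k * ellipticK k *
        (2 * Real.pi / (k * ellipticK k) *
          (Real.sqrt (nome k) ^ (2 * l + 1) / (1 - nome k ^ (2 * l + 1))) / 2)) =
        (Real.sqrt 2 * 2 ^ (3 / 2 : ℝ)) * Real.pi * (n : ℕ) *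
          (Real.sqrt (nome k) ^ (2 * l + 1) / (1 - nome k ^ (2 * l + 1))) := by
      generalize Real.sqrt (nome k) ^ (2 * l + 1) / (1 - nome k ^ (2 * l + 1)) = y
      field_simp
    rw [this, h2]
  · ring

theorem continuous_gpFun (n : ℕ+) {k : ℝ} (hk : k ∈ Ioo (0 : ℝ) 1) : Continuous (gpFun n k) := by
  have hk2 := sq_lt_one_of_mem_Ioo hk
  unfold gpFun
  simp only [jacobiSn_eq hk2]
  exact continuous_const.mul
    (Real.continuous_sin.comp ((continuous_jacobiAm hk2).comp (by fun_prop)))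

/-! ### The sine basis of `L²` and the sequence space of `H^α` -/

section SineBasis

variable (𝕜 : Type*) [RCLike 𝕜]

theorem continuous_sine (n : ℕ+) :
    Continuous fun x : ℝ => ((Real.sqrt 2 * Real.sin ((n : ℕ) * Real.pi * x) : ℝ) : 𝕜) :=
  RCLike.continuous_ofReal.comp (by fun_prop)

/-- The function `√2 sin(nπx)` in `L²(0, 1)`. -/
noncomputable def sineLp (n : ℕ+) : Lp 𝕜 2 unitMeasure :=
  (continuous_sine 𝕜 n).memLp_unitMeasure.toLp _

variable {𝕜} in
theorem inner_sineLp (n : ℕ+) (f : Lp 𝕜 2 unitMeasure) :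
    inner 𝕜 (sineLp 𝕜 n) f = sineCoeff f n := by
  rw [L2.inner_def, sineCoeff, ← integral_smul]
  refine integral_congr_ae ?_
  filter_upwards [MemLp.coeFn_toLp (continuous_sine 𝕜 n).memLp_unitMeasure] with x hx
  rw [sineLp, hx, RCLike.inner_apply, RCLike.conj_ofReal, RCLike.real_smul_eq_coe_mul,
    RCLike.real_smul_eq_coe_mul]
  push_cast
  ring

theorem orthonormal_sineLp : Orthonormal 𝕜 (sineLp 𝕜) := by
  rw [orthonormal_iff_ite]
  intro n m
  rw [inner_sineLp, sineLp, sineCoeff_congr (MemLp.coeFn_toLp _), sineCoeff_ofReal]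
  have h : ∀ x : ℝ, Real.sin ((n : ℕ) * Real.pi * x) *
      (Real.sqrt 2 * Real.sin ((m : ℕ) * Real.pi * x)) = Real.sqrt 2 *
        (Real.sin ((n : ℕ) * Real.pi * x) * Real.sin ((m : ℕ) * Real.pi * x)) := fun x => by ring
  simp only [h]
  rw [intervalIntegral.integral_const_mul, integral_sin_mul_sin, ← mul_assoc,
    Real.mul_self_sqrt zero_le_two]
  by_cases hnm : n = m
  · simp [hnm]
  · simp [hnm, Ne.symm hnm]

/-- The functions `√2 sin(nπx)` as a Hilbert basis of `L²(0, 1)`. -/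
noncomputable def sineBasis : HilbertBasis ℕ+ 𝕜 (Lp 𝕜 2 unitMeasure) :=
  HilbertBasis.mkOfOrthogonalEqBot (orthonormal_sineLp 𝕜) (by
    rw [Submodule.eq_bot_iff]
    intro f hf
    have h : ∀ n, sineCoeff f n = 0 := fun n => by
      rw [← inner_sineLp]
      exact hf _ (Submodule.subset_span (mem_range_self n))
    refine Lp.ext ((ae_zero_of_sineCoeff_eq_zero (Lp.memLp f) h).trans ?_)
    exact (Lp.coeFn_zero 𝕜 2 unitMeasure).symm)

theorem sineBasis_repr (f : Lp 𝕜 2 unitMeasure) (n : ℕ+) :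
    (sineBasis 𝕜).repr f n = sineCoeff f n := by
  rw [HilbertBasis.repr_apply_apply, sineBasis, HilbertBasis.coe_mkOfOrthogonalEqBot, inner_sineLp]

/-- Every square summable sequence is the sequence of weighted sine coefficients of a function: for
`α ≥ 0` its unweighted form is square summable too. -/
theorem toSeq_surjective {α : ℝ} (hα : 0 ≤ α) : Function.Surjective (SobolevH.toSeq 𝕜 α) := by
  intro x
  have hy : Memℓp (fun n : ℕ+ => (((n : ℕ) : ℝ) ^ α)⁻¹ • x n) 2 := by
    refine (lp.memℓp x).mono' fun n => ?_
    have h1 : (1 : ℝ) ≤ ((n : ℕ) : ℝ) ^ α :=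
      Real.one_le_rpow (Nat.one_le_cast.2 n.pos) hα
    rw [norm_smul, Real.norm_of_nonneg (by positivity)]
    exact mul_le_of_le_one_left (norm_nonneg _) (inv_le_one_of_one_le₀ h1)
  set f := (sineBasis 𝕜).repr.symm ⟨_, hy⟩ with hf
  have hcoeff : ∀ n, sineCoeff f n = (((n : ℕ) : ℝ) ^ α)⁻¹ • x n := fun n => by
    rw [← sineBasis_repr, hf, LinearIsometryEquiv.apply_symm_apply]
  have hw : weightedCoeff 𝕜 α f = x := by
    funext n
    change ((n : ℕ) : ℝ) ^ α • sineCoeff f n = x n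
    have h0 : (0 : ℝ) < (n : ℕ) := Nat.cast_pos.2 n.pos
    rw [hcoeff, smul_inv_smul₀ (Real.rpow_pos_of_pos h0 α).ne']
  refine ⟨⟨f, (memℓp_weightedCoeff_iff α f).1 (hw ▸ lp.memℓp x)⟩, ?_⟩
  ext n
  exact congrFun hw n

/-- `H^α` is isometric to `ℓ²` through the weighted sine coefficients. -/
noncomputable def sobolevEquiv {α : ℝ} (hα : 0 ≤ α) :
    SobolevH 𝕜 α ≃ₗᵢ[𝕜] lp (fun _ : ℕ+ => 𝕜) 2 :=
  LinearIsometryEquiv.ofSurjective ⟨SobolevH.toSeq 𝕜 α, fun _ => rfl⟩ (toSeq_surjective 𝕜 hα)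

theorem sobolevEquiv_apply {α : ℝ} (hα : 0 ≤ α) (f : SobolevH 𝕜 α) (n : ℕ+) :
    sobolevEquiv 𝕜 hα f n = ((n : ℕ) : ℝ) ^ α • sineCoeff (SobolevH.toL2 f) n := rfl

end SineBasis

/-! ### The threshold -/

/-- The term `(1 - q) q^l / (1 - q^(2 l + 1))` of the series `s_α`, without its weight. -/
noncomputable def sTerm (l : ℕ) (q : ℝ) : ℝ := (1 - q) * q ^ l / (1 - q ^ (2 * l + 1))

theorem sTerm_eq_div_geom_sum {q : ℝ} (h1 : q < 1) (l : ℕ) :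
    sTerm l q = q ^ l / ∑ i ∈ Finset.range (2 * l + 1), q ^ i := by
  have h2 : 0 < 1 - q := by linarith
  rw [sTerm, ← geom_sum_mul_neg, mul_comm, mul_div_mul_right _ _ h2.ne']

theorem one_le_geom_sum_odd {q : ℝ} (h0 : 0 ≤ q) (l : ℕ) :
    1 ≤ ∑ i ∈ Finset.range (2 * l + 1), q ^ i := by
  rw [Finset.sum_range_succ', pow_zero]
  exact le_add_of_nonneg_left (Finset.sum_nonneg fun i _ => by positivity)

theorem sTerm_nonneg {q : ℝ} (h0 : 0 ≤ q) (h1 : q < 1) (l : ℕ) : 0 ≤ sTerm l q := by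
  rw [sTerm_eq_div_geom_sum h1]
  positivity

theorem sTerm_zero_left {q : ℝ} (h1 : q < 1) : sTerm 0 q = 1 := by
  have h2 : 1 - q ≠ 0 := by linarith
  simp [sTerm, h2]

theorem sTerm_zero_right {l : ℕ} (hl : l ≠ 0) : sTerm l 0 = 0 := by simp [sTerm, hl]

theorem sTerm_le_pow {q : ℝ} (h0 : 0 ≤ q) (h1 : q < 1) (l : ℕ) : sTerm l q ≤ q ^ l := by
  rw [sTerm_eq_div_geom_sum h1]
  exact div_le_self (by positivity) (one_le_geom_sum_odd h0 l)

theorem le_sTerm {q : ℝ} (h0 : 0 ≤ q) (h1 : q < 1) (l : ℕ) :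
    q ^ l / (2 * l + 1) ≤ sTerm l q := by
  rw [sTerm_eq_div_geom_sum h1]
  have h2 := one_le_geom_sum_odd h0 l
  gcongr
  calc ∑ i ∈ Finset.range (2 * l + 1), q ^ i ≤ ∑ i ∈ Finset.range (2 * l + 1), (1 : ℝ) :=
        Finset.sum_le_sum fun i _ => pow_le_one₀ h0 h1.le
    _ = 2 * l + 1 := by simp

/-- The monotonicity of `x ^ l / (1 + x + ⋯ + x ^ (2 l))` on `[0, 1]`, cleared of denominators. -/
theorem pow_mul_geom_sum_le {x y : ℝ} (h0 : 0 ≤ x) (hxy : x ≤ y) (h1 : y ≤ 1) (l : ℕ) :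
    x ^ l * ∑ i ∈ Finset.range (2 * l + 1), y ^ i ≤
      y ^ l * ∑ i ∈ Finset.range (2 * l + 1), x ^ i := by
  have hsucc : ∀ (z : ℝ) (l : ℕ), ∑ i ∈ Finset.range (2 * (l + 1) + 1), z ^ i =
      1 + z * ∑ i ∈ Finset.range (2 * l + 1), z ^ i + z ^ (2 * l + 2) := fun z l => by
    rw [show 2 * (l + 1) + 1 = (2 * l + 1 + 1) + 1 by ring, Finset.sum_range_succ,
      Finset.sum_range_succ', Finset.mul_sum, pow_zero, add_comm (1 : ℝ)]
    simp only [pow_succ']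
  induction l with
  | zero => simp
  | succ l ih =>
    rw [hsucc, hsucc]
    have hy0 : 0 ≤ y := h0.trans hxy
    have h2 := mul_le_mul_of_nonneg_left ih (mul_nonneg h0 hy0)
    have hX : x ^ (l + 1) ≤ y ^ (l + 1) := pow_le_pow_left₀ h0 hxy _
    have hY : y ^ (l + 1) ≤ 1 := pow_le_one₀ hy0 h1
    have hX0 : 0 ≤ x ^ (l + 1) := by positivity
    have h3 : 0 ≤ (y ^ (l + 1) - x ^ (l + 1)) * (1 - x ^ (l + 1) * y ^ (l + 1)) :=
      mul_nonneg (by linarith) (by nlinarith)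
    have e : ∀ z : ℝ, z ^ (2 * l + 2) = (z ^ (l + 1)) ^ 2 := fun z => by ring
    rw [e, e]
    have e2 : ∀ z w : ℝ, z * w * (z ^ l * ∑ i ∈ Finset.range (2 * l + 1), w ^ i) =
        z ^ (l + 1) * (w * ∑ i ∈ Finset.range (2 * l + 1), w ^ i) := fun z w => by ring
    rw [e2, mul_comm x y, e2] at h2
    nlinarith

theorem sTerm_mono {x y : ℝ} (h0 : 0 ≤ x) (hxy : x ≤ y) (h1 : y < 1) (l : ℕ) :
    sTerm l x ≤ sTerm l y := by
  rw [sTerm_eq_div_geom_sum (hxy.trans_lt h1), sTerm_eq_div_geom_sum h1,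
    div_le_div_iff₀ (one_pos.trans_le (one_le_geom_sum_odd h0 l))
      (one_pos.trans_le (one_le_geom_sum_odd (h0.trans hxy) l))]
  exact pow_mul_geom_sum_le h0 hxy h1.le l

theorem sTerm_one_lt {x y : ℝ} (h0 : 0 ≤ x) (hxy : x < y) (h1 : y < 1) :
    sTerm 1 x < sTerm 1 y := by
  rw [sTerm_eq_div_geom_sum (hxy.trans h1), sTerm_eq_div_geom_sum h1,
    div_lt_div_iff₀ (one_pos.trans_le (one_le_geom_sum_odd h0 1))
      (one_pos.trans_le (one_le_geom_sum_odd (h0.trans hxy.le) 1))]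
  simp only [mul_one, Nat.reduceAdd, Finset.sum_range_succ, Finset.sum_range_zero]
  nlinarith [mul_pos (sub_pos.2 hxy) (show 0 < 1 - x * y by nlinarith)]

/-- The index of the term of `s_α` with frequency `(2 j + 1)²`: it is `((2 j + 1)² - 1) / 2`. -/
def squareIndex (j : ℕ) : ℕ := 2 * j * (j + 1)

theorem two_mul_squareIndex (j : ℕ) : 2 * squareIndex j + 1 = (2 * j + 1) ^ 2 := by
  unfold squareIndex; ring

/-- With `p = 2 j + 1`, the factor `1 - q ^ p` cancels in the product on the right. -/
theorem sTerm_squareIndex {q : ℝ} (h0 : 0 < q) (h1 : q < 1) (j : ℕ) :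
    sTerm (squareIndex j) q = sTerm j q * sTerm j (q ^ (2 * j + 1)) := by
  have hp : q ^ (2 * j + 1) < 1 := pow_lt_one₀ h0.le h1 (Nat.succ_ne_zero _)
  have hpp : (q ^ (2 * j + 1)) ^ (2 * j + 1) < 1 :=
    pow_lt_one₀ (by positivity) hp (Nat.succ_ne_zero _)
  have e1 : 1 - q ^ (2 * j + 1) ≠ 0 := by linarith
  have e2 : 1 - (q ^ (2 * j + 1)) ^ (2 * j + 1) ≠ 0 := by linarith
  have e3 : q ^ squareIndex j = q ^ j * (q ^ (2 * j + 1)) ^ j := by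
    rw [← pow_mul, ← pow_add, squareIndex]; ring_nf
  rw [sTerm, sTerm, sTerm, two_mul_squareIndex, sq, pow_mul, e3]
  generalize q ^ (2 * j + 1) = z at *
  field_simp

/-- The term of frequency `p²` is dominated by the square of the term of frequency `p`. -/
theorem sTerm_squareIndex_le {q : ℝ} (h0 : 0 < q) (h1 : q < 1) (j : ℕ) :
    sTerm (squareIndex j) q ≤ sTerm j q ^ 2 := by
  rw [sTerm_squareIndex h0 h1, sq]
  exact mul_le_mul_of_nonneg_left
    (sTerm_mono (by positivity) (pow_le_of_le_one h0.le h1.le (Nat.succ_ne_zero _)) h1 j)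
    (sTerm_nonneg h0.le h1 j)

theorem summable_odd_rpow_mul_geometric (α : ℝ) {ρ : ℝ} (h0 : 0 < ρ) (h1 : ρ < 1) :
    Summable fun l : ℕ => (2 * (l : ℝ) + 1) ^ α * ρ ^ l := by
  obtain ⟨K, hK⟩ := exists_nat_ge α
  have hs1 : Real.sqrt ρ < 1 := by rw [Real.sqrt_lt' one_pos]; simpa using h1
  have hs0 : 0 < Real.sqrt ρ := Real.sqrt_pos.2 h0
  have h := (summable_pow_mul_geometric_of_norm_lt_one K (r := Real.sqrt ρ)
    (by rwa [Real.norm_of_nonneg hs0.le])).comp_injective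
      (i := fun l : ℕ => 2 * l + 1) (fun a b hab => by simpa using hab)
  refine Summable.of_nonneg_of_le (fun l => by positivity) (fun l => ?_)
    (h.mul_left (Real.sqrt ρ)⁻¹)
  have hρ : (Real.sqrt ρ)⁻¹ * Real.sqrt ρ ^ (2 * l + 1) = ρ ^ l := by
    rw [pow_succ, pow_mul, Real.sq_sqrt h0.le]
    field_simp
  have hl : (1 : ℝ) ≤ 2 * l + 1 := by linarith [Nat.cast_nonneg (α := ℝ) l]
  calc (2 * (l : ℝ) + 1) ^ α * ρ ^ l ≤ (2 * (l : ℝ) + 1) ^ K * ρ ^ l := by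
        gcongr
        rw [← Real.rpow_natCast]
        exact Real.rpow_le_rpow_of_exponent_le hl hK
    _ = (Real.sqrt ρ)⁻¹ * (((2 * l + 1 : ℕ) : ℝ) ^ K * Real.sqrt ρ ^ (2 * l + 1)) := by
        rw [← hρ]; push_cast; ring

theorem summable_sTerm (α : ℝ) {q : ℝ} (h0 : 0 < q) (h1 : q < 1) :
    Summable fun l : ℕ => (2 * (l : ℝ) + 1) ^ α * sTerm l q := by
  refine Summable.of_nonneg_of_le
    (fun l => mul_nonneg (by positivity) (sTerm_nonneg h0.le h1 l)) (fun l => ?_)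
    (summable_odd_rpow_mul_geometric α h0 h1)
  gcongr
  exact sTerm_le_pow h0.le h1 l

/-- The weight `(2 l + 1)^α`, diminished by `p^α / 2` at the frequency `p²`, where `p = 2 j + 1`.
With these weights the equation of the threshold becomes `∑ w_l b_l(q) = 2`. -/
noncomputable def thresholdWeight (j : ℕ) (α : ℝ) (l : ℕ) : ℝ :=
  (2 * (l : ℝ) + 1) ^ α - if l = squareIndex j then (2 * (j : ℝ) + 1) ^ α / 2 else 0

theorem thresholdWeight_le (j : ℕ) (α : ℝ) (l : ℕ) :
    thresholdWeight j α l ≤ (2 * (l : ℝ) + 1) ^ α := by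
  unfold thresholdWeight
  split_ifs
  · have : 0 ≤ (2 * (j : ℝ) + 1) ^ α := by positivity
    linarith
  · simp

theorem odd_rpow_le_squareIndex (j : ℕ) {α : ℝ} (hα : 0 ≤ α) :
    (2 * (j : ℝ) + 1) ^ α ≤ (2 * (squareIndex j : ℝ) + 1) ^ α := by
  refine Real.rpow_le_rpow (by positivity) ?_ hα
  have h := two_mul_squareIndex j
  have h2 : (2 * (squareIndex j : ℝ) + 1) = (2 * (j : ℝ) + 1) ^ 2 := by exact_mod_cast h
  rw [h2]
  nlinarith [Nat.cast_nonneg (α := ℝ) j]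

theorem le_thresholdWeight (j : ℕ) {α : ℝ} (hα : 0 ≤ α) (l : ℕ) :
    1 / 2 ≤ thresholdWeight j α l := by
  have h1 : 1 ≤ (2 * (l : ℝ) + 1) ^ α :=
    Real.one_le_rpow (by linarith [Nat.cast_nonneg (α := ℝ) l]) hα
  unfold thresholdWeight
  split_ifs with h
  · have h2 := odd_rpow_le_squareIndex j hα
    rw [← h] at h2
    linarith
  · linarith

theorem summable_thresholdWeight (j : ℕ) {α : ℝ} (hα : 0 ≤ α) {q : ℝ} (h0 : 0 < q) (h1 : q < 1) :
    Summable fun l : ℕ => thresholdWeight j α l * sTerm l q := by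
  refine Summable.of_nonneg_of_le (fun l => mul_nonneg ?_ (sTerm_nonneg h0.le h1 l)) (fun l => ?_)
    (summable_sTerm α h0 h1)
  · linarith [le_thresholdWeight j hα l]
  · exact mul_le_mul_of_nonneg_right (thresholdWeight_le j α l) (sTerm_nonneg h0.le h1 l)

theorem tsum_thresholdWeight (j : ℕ) (α : ℝ) {q : ℝ} (h0 : 0 < q) (h1 : q < 1) :
    ∑' l, thresholdWeight j α l * sTerm l q =
      sSeries α q - (2 * (j : ℝ) + 1) ^ α / 2 * sTerm (squareIndex j) q := by
  have h2 := hasSum_ite_eq (squareIndex j)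
    ((2 * (j : ℝ) + 1) ^ α / 2 * sTerm (squareIndex j) q)
  have h3 := (summable_sTerm α h0 h1).hasSum.sub h2
  refine Eq.trans (tsum_congr fun l => ?_) h3.tsum_eq
  rw [thresholdWeight, sub_mul]
  split_ifs with h
  · rw [h]
  · simp

theorem isThreshold_iff {p : ℕ+} {j : ℕ} (hj : (p : ℕ) = 2 * j + 1) (α r : ℝ) :
    IsThreshold p α r ↔ r ∈ Ioo (0 : ℝ) 1 ∧ ∑' l, thresholdWeight j α l * sTerm l r = 2 := by
  refine and_congr_right fun hr => ?_
  have hp : ((p : ℕ) ^ 2 - 1) / 2 = squareIndex j := by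
    have := two_mul_squareIndex j
    rw [hj]
    omega
  rw [tsum_thresholdWeight j α hr.1 hr.2, hp, sTerm, two_mul_squareIndex, hj, sub_eq_iff_eq_add]
  push_cast
  rw [show (2 * (j : ℝ) + 1) ^ α / 2 * ((1 - r) * r ^ squareIndex j / (1 - r ^ (2 * j + 1) ^ 2)) =
    (2 * (j : ℝ) + 1) ^ α * (1 - r) * r ^ squareIndex j / (2 * (1 - r ^ (2 * j + 1) ^ 2)) by
      rw [div_mul_div_comm, mul_assoc]]

theorem tsum_thresholdWeight_lt (j : ℕ) {α : ℝ} (hα : 0 ≤ α) {x y : ℝ} (h0 : 0 < x) (hxy : x < y)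
    (h1 : y < 1) :
    ∑' l, thresholdWeight j α l * sTerm l x < ∑' l, thresholdWeight j α l * sTerm l y := by
  have hw : ∀ l, 0 < thresholdWeight j α l := fun l => by linarith [le_thresholdWeight j hα l]
  refine Summable.tsum_lt_tsum (i := 1) (fun l => ?_) ?_
    (summable_thresholdWeight j hα h0 (hxy.trans h1))
    (summable_thresholdWeight j hα (h0.trans hxy) h1)
  · exact mul_le_mul_of_nonneg_left (sTerm_mono h0.le hxy.le h1 l) (hw l).le
  · exact mul_lt_mul_of_pos_left (sTerm_one_lt h0.le hxy h1) (hw 1)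

/-- The series exceeds `2` near `q = 1`: it is bounded below by multiples of `∑ q^l / (2 l + 1)`,
and the harmonic series diverges. -/
theorem exists_two_lt_tsum_thresholdWeight (j : ℕ) {α : ℝ} (hα : 0 ≤ α) :
    ∃ q ∈ Ioo (0 : ℝ) 1, 2 < ∑' l, thresholdWeight j α l * sTerm l q := by
  -- with `q = 1 - 1 / (4 N)` all the powers `q ^ l`, `l ≤ N`, are at least `3 / 4`
  obtain ⟨N, hN1, hN⟩ := ((Filter.eventually_ge_atTop 1).and
    (Real.tendsto_sum_range_one_div_nat_succ_atTop.eventually_ge_atTop 16)).exists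
  have hN0 : (1 : ℝ) ≤ N := Nat.one_le_cast.2 hN1
  set q : ℝ := 1 - 1 / (4 * N) with hq
  have hle : 1 / (4 * (N : ℝ)) ≤ 1 / 4 := by
    rw [div_le_div_iff₀ (by positivity) (by positivity)]; linarith
  have hpos : 0 < 1 / (4 * (N : ℝ)) := by positivity
  have hq0 : 0 < q := by rw [hq]; linarith
  have hq1 : q < 1 := by rw [hq]; linarith
  have hqN : 3 / 4 ≤ q ^ N := by
    have h := one_add_mul_le_pow (a := -(1 / (4 * (N : ℝ)))) (by linarith) N
    rw [← sub_eq_add_neg, ← hq] at h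
    refine le_trans (le_of_eq ?_) h
    field_simp
    norm_num
  refine ⟨q, ⟨hq0, hq1⟩, ?_⟩
  have h1 := (summable_thresholdWeight j hα hq0 hq1).sum_le_tsum (Finset.range N) fun l _ =>
    mul_nonneg (by linarith [le_thresholdWeight j hα l]) (sTerm_nonneg hq0.le hq1 l)
  have h2 : ∑ l ∈ Finset.range N, (3 / 16 : ℝ) * (1 / ((l : ℝ) + 1)) ≤
      ∑ l ∈ Finset.range N, thresholdWeight j α l * sTerm l q := by
    refine Finset.sum_le_sum fun l hl => ?_
    have h3 : q ^ N ≤ q ^ l := pow_le_pow_of_le_one hq0.le hq1.le (Finset.mem_range.1 hl).le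
    have hl0 := Nat.cast_nonneg (α := ℝ) l
    calc (3 / 16 : ℝ) * (1 / ((l : ℝ) + 1)) = 1 / 2 * (3 / 4 / (2 * l + 2)) := by
          field_simp; norm_num
      _ ≤ 1 / 2 * (q ^ l / (2 * l + 1)) := by gcongr <;> linarith
      _ ≤ thresholdWeight j α l * sTerm l q := by
          gcongr
          · linarith [le_thresholdWeight j hα l]
          · exact le_thresholdWeight j hα l
          · exact le_sTerm hq0.le hq1 l
  rw [← Finset.mul_sum] at h2
  linarith

theorem continuousOn_sTerm (l : ℕ) : ContinuousOn (sTerm l) (Ico 0 1) := by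
  refine ContinuousOn.div (by fun_prop) (by fun_prop) fun x hx => ?_
  have := pow_lt_one₀ hx.1 hx.2 (Nat.succ_ne_zero (2 * l))
  exact (sub_pos.2 this).ne'

/-- The weighted series increases continuously from the value `1` at `q = 0` to values above `2`. -/
theorem existsUnique_isThreshold {p : ℕ+} {j : ℕ} (hj : (p : ℕ) = 2 * j + 1) (hj0 : j ≠ 0) {α : ℝ}
    (hα : 0 ≤ α) : ∃! r : ℝ, IsThreshold p α r := by
  simp only [isThreshold_iff hj]
  obtain ⟨ρ, hρ, h2⟩ := exists_two_lt_tsum_thresholdWeight j hα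
  have hcont : ContinuousOn (fun q => ∑' l, thresholdWeight j α l * sTerm l q) (Icc 0 ρ) := by
    refine continuousOn_tsum
      (fun l => continuousOn_const.mul ((continuousOn_sTerm l).mono fun x hx =>
        ⟨hx.1, hx.2.trans_lt hρ.2⟩))
      (summable_odd_rpow_mul_geometric α hρ.1 hρ.2) fun l x hx => ?_
    have hx1 := hx.2.trans_lt hρ.2
    have hw : 0 ≤ thresholdWeight j α l := by linarith [le_thresholdWeight j hα l]
    rw [Real.norm_of_nonneg (mul_nonneg hw (sTerm_nonneg hx.1 hx1 l))]
    refine mul_le_mul (thresholdWeight_le j α l) ?_ (sTerm_nonneg hx.1 hx1 l) (by positivity)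
    exact (sTerm_le_pow hx.1 hx1 l).trans (pow_le_pow_left₀ hx.1 hx.2 l)
  have hzero : ∑' l, thresholdWeight j α l * sTerm l 0 = 1 := by
    rw [tsum_eq_single 0 fun l hl => by rw [sTerm_zero_right hl, mul_zero],
      sTerm_zero_left one_pos, mul_one, thresholdWeight, if_neg]
    · simp
    · simp [squareIndex, hj0, eq_comm]
  obtain ⟨r, hr, hr2⟩ := intermediate_value_Icc hρ.1.le hcont
    ⟨hzero.le.trans one_le_two, h2.le⟩
  have hr0 : r ≠ 0 := fun h => by
    rw [h] at hr2
    simp only [hzero] at hr2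
    norm_num at hr2
  have hrmem : r ∈ Ioo (0 : ℝ) 1 := ⟨lt_of_le_of_ne hr.1 hr0.symm, hr.2.trans_lt hρ.2⟩
  refine ⟨r, ⟨hrmem, hr2⟩, fun y hy => ?_⟩
  rcases lt_trichotomy y r with h | h | h
  · have := tsum_thresholdWeight_lt j hα hy.1.1 h hrmem.2
    exact absurd (hy.2.symm.trans_lt this) (by simp only at hr2; rw [hr2]; exact lt_irrefl _)
  · exact h
  · have := tsum_thresholdWeight_lt j hα hrmem.1 h hy.1.2
    exact absurd (this.trans_eq hy.2) (by simp only at hr2; rw [hr2]; exact lt_irrefl _)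

/-- What the threshold gives for the basis property; the factor `p^α` is replaced here by the larger
weight `p^(2 α)` of the frequency `p²`. -/
theorem sSeries_lt_of_lt_threshold {p : ℕ+} {j : ℕ} (hj : (p : ℕ) = 2 * j + 1) {α : ℝ}
    (hα : 0 ≤ α) {r q : ℝ} (hr : IsThreshold p α r) (h0 : 0 < q) (hqr : q < r) :
    sSeries α q <
      2 + (2 * (squareIndex j : ℝ) + 1) ^ α * sTerm (squareIndex j) q / 2 := by
  obtain ⟨hr1, hr2⟩ := (isThreshold_iff hj α r).1 hr
  have h := tsum_thresholdWeight_lt j hα h0 hqr hr1.2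
  have hq1 := hqr.trans hr1.2
  rw [hr2, tsum_thresholdWeight j α h0 hq1] at h
  have h3 := mul_le_mul_of_nonneg_right (odd_rpow_le_squareIndex j hα)
    (sTerm_nonneg h0.le hq1 (squareIndex j))
  linarith

/-! ### Perturbation of the square of a perturbed identity -/

/-- If `X` is close to `(1 + b)²`, where `‖b‖ < 1`, then `X` is invertible. -/
theorem isUnit_of_norm_sub_sq_lt {R : Type*} [NormedRing R] [CompleteSpace R] (hone : ‖(1 : R)‖ ≤ 1)
    {b X : R} {β : ℝ} (hb : ‖b‖ ≤ β) (hβ : β < 1) (hX : ‖X - (1 + b) ^ 2‖ < (1 - β) ^ 2) :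
    IsUnit X := by
  have hu : IsUnit (1 + b) := by
    have h := isUnit_one_sub_of_norm_lt_one (x := -b) (by rw [norm_neg]; linarith)
    rwa [sub_neg_eq_add] at h
  obtain ⟨u, hu⟩ := hu
  rw [← hu] at hX
  have hpos : 0 < 1 - β := by linarith
  have hinv : ‖(↑u⁻¹ : R)‖ ≤ (1 - β)⁻¹ := by
    have h1 : (↑u⁻¹ : R) = 1 - b * ↑u⁻¹ := by
      rw [eq_sub_iff_add_eq]
      calc (↑u⁻¹ : R) + b * ↑u⁻¹ = (1 + b) * ↑u⁻¹ := by rw [add_mul, one_mul]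
        _ = 1 := by rw [← hu, Units.mul_inv]
    have h2 : ‖(↑u⁻¹ : R)‖ ≤ 1 + β * ‖(↑u⁻¹ : R)‖ := by
      conv_lhs => rw [h1]
      refine (norm_sub_le _ _).trans (add_le_add hone ((norm_mul_le _ _).trans ?_))
      gcongr
    rw [← one_div (1 - β), le_div_iff₀ hpos]
    linarith
  have hsmall : ‖-((↑u⁻¹ : R) * ↑u⁻¹ * (X - ↑u ^ 2))‖ < 1 := by
    rw [norm_neg]
    calc ‖(↑u⁻¹ : R) * ↑u⁻¹ * (X - ↑u ^ 2)‖ ≤ ‖(↑u⁻¹ : R)‖ * ‖(↑u⁻¹ : R)‖ * ‖X - ↑u ^ 2‖ :=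
          (norm_mul_le _ _).trans (by gcongr; exact norm_mul_le _ _)
      _ ≤ (1 - β)⁻¹ * (1 - β)⁻¹ * ‖X - ↑u ^ 2‖ := by gcongr
      _ < (1 - β)⁻¹ * (1 - β)⁻¹ * (1 - β) ^ 2 := by gcongr
      _ = 1 := by field_simp
  have h3 := isUnit_one_sub_of_norm_lt_one hsmall
  have h4 : X = ↑u * ↑u * (1 - -((↑u⁻¹ : R) * ↑u⁻¹ * (X - ↑u ^ 2))) := by
    rw [sub_neg_eq_add, mul_add, mul_one, ← mul_assoc, mul_assoc (u : R),
      ← mul_assoc (u : R) (↑u⁻¹),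
      Units.mul_inv, one_mul, Units.mul_inv, one_mul, sq]
    abel
  rw [h4]
  exact (u.isUnit.mul u.isUnit).mul h3

/-! ### Weighted dilations of `ℓ²` -/

section Dilation

variable (𝕜 : Type*) [RCLike 𝕜]

theorem orthonormal_single_mul (j : ℕ+) :
    Orthonormal 𝕜 fun n : ℕ+ => lp.single (E := fun _ : ℕ+ => 𝕜) 2 (j * n) 1 := by
  rw [orthonormal_iff_ite]
  intro n m
  rw [lp.inner_single_left, lp.single_apply, Pi.single_apply]
  simp [mul_right_inj]

/-- The operator on `ℓ²(ℕ+)` which maps the unit vector `δ_n` to `g n • δ_{jn}`. -/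
noncomputable def weightedDilation (j : ℕ+) {g : ℕ+ → ℝ} {C : ℝ} (hg : ∀ n, |g n| ≤ C) :
    lp (fun _ : ℕ+ => 𝕜) 2 →L[𝕜] lp (fun _ : ℕ+ => 𝕜) 2 :=
  (orthonormal_single_mul 𝕜 j).orthogonalFamily.linearIsometry.toContinuousLinearMap ∘L
    lp.mapCLM 2 (fun n => (g n : 𝕜) • ContinuousLinearMap.id 𝕜 𝕜) ((abs_nonneg _).trans (hg 1))
      (fun n => by
        refine (norm_smul_le _ _).trans ?_
        rw [RCLike.norm_ofReal]
        exact (mul_le_of_le_one_right (abs_nonneg _) ContinuousLinearMap.norm_id_le).trans (hg n))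

variable {𝕜}

theorem norm_weightedDilation_le (j : ℕ+) {g : ℕ+ → ℝ} {C : ℝ} (hg : ∀ n, |g n| ≤ C) :
    ‖weightedDilation 𝕜 j hg‖ ≤ C := by
  refine (ContinuousLinearMap.opNorm_comp_le _ _).trans ?_
  refine (mul_le_of_le_one_left (norm_nonneg _) ?_).trans (lp.norm_mapCLM_le _ _ _ _)
  exact LinearIsometry.norm_toContinuousLinearMap_le _

theorem weightedDilation_single (j : ℕ+) {g : ℕ+ → ℝ} {C : ℝ} (hg : ∀ n, |g n| ≤ C) (n : ℕ+)
    (a : 𝕜) :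
    weightedDilation 𝕜 j hg (lp.single (E := fun _ : ℕ+ => 𝕜) 2 n a) =
      lp.single (E := fun _ : ℕ+ => 𝕜) 2 (j * n) ((g n : 𝕜) * a) := by
  have h : lp.mapCLM 2 (fun n => (g n : 𝕜) • ContinuousLinearMap.id 𝕜 𝕜)
      ((abs_nonneg _).trans (hg 1)) (fun n => by
        refine (norm_smul_le _ _).trans ?_
        rw [RCLike.norm_ofReal]
        exact (mul_le_of_le_one_right (abs_nonneg _) ContinuousLinearMap.norm_id_le).trans (hg n))
      (lp.single (E := fun _ : ℕ+ => 𝕜) 2 n a) =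
        lp.single (E := fun _ : ℕ+ => 𝕜) 2 n ((g n : 𝕜) * a) := by
    ext m
    rw [lp.mapCLM_apply_coe]
    simp only [lp.single_apply, Pi.single_apply]
    split_ifs with hm
    · subst hm; simp
    · simp
  rw [weightedDilation, ContinuousLinearMap.comp_apply, h]
  simp only [LinearIsometry.coe_toContinuousLinearMap, OrthogonalFamily.linearIsometry_apply_single,
    LinearIsometry.toSpanSingleton_apply, ← lp.single_smul, smul_eq_mul, mul_one]

theorem clm_ext_single {T S : lp (fun _ : ℕ+ => 𝕜) 2 →L[𝕜] lp (fun _ : ℕ+ => 𝕜) 2}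
    (h : ∀ n, T (lp.single (E := fun _ : ℕ+ => 𝕜) 2 n 1) =
      S (lp.single (E := fun _ : ℕ+ => 𝕜) 2 n 1)) : T = S := by
  refine lp.ext_continuousLinearMap (by norm_num) fun n => ?_
  ext1
  exact h n

/-- The operator `δ_n ↦ ∑_l (2 l + 1)^α b_l(q_n) δ_{(2 l + 1) n}` is invertible below the threshold,
if `q` is invariant under `n ↦ p n`, where `p = 2 j + 1`. -/
theorem exists_isUnit_dilationSeries {p : ℕ+} {j : ℕ} (hj : (p : ℕ) = 2 * j + 1) (hj0 : j ≠ 0)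
    {α : ℝ} {Q : ℝ} (hQ : Q ∈ Ioo (0 : ℝ) 1)
    (hs : sSeries α Q <
      2 + (2 * (squareIndex j : ℝ) + 1) ^ α * sTerm (squareIndex j) Q / 2)
    {q : ℕ+ → ℝ} (hq : ∀ n, q n ∈ Ioo (0 : ℝ) 1) (hqQ : ∀ n, q n ≤ Q)
    (hqp : ∀ n, q n = q (p * n)) :
    ∃ A : lp (fun _ : ℕ+ => 𝕜) 2 →L[𝕜] lp (fun _ : ℕ+ => 𝕜) 2, IsUnit A ∧
      ∀ n m, A (lp.single (E := fun _ : ℕ+ => 𝕜) 2 n 1) m =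
        ((∑' l, if oddPNat l * n = m then (2 * (l : ℝ) + 1) ^ α * sTerm l (q n) else 0 : ℝ) :
          𝕜) := by
  set f : ℕ → ℝ → ℝ := fun l x => (2 * (l : ℝ) + 1) ^ α * sTerm l x with hf
  have hf0 : ∀ l n, 0 ≤ f l (q n) := fun l n =>
    mul_nonneg (by positivity) (sTerm_nonneg (hq n).1.le (hq n).2 l)
  have hfQ : ∀ l n, f l (q n) ≤ f l Q := fun l n =>
    mul_le_mul_of_nonneg_left (sTerm_mono (hq n).1.le (hqQ n) hQ.2 l) (by positivity)
  have hfabs : ∀ l n, |f l (q n)| ≤ f l Q := fun l n => by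
    rw [abs_of_nonneg (hf0 l n)]; exact hfQ l n
  have hfQ0 : ∀ l, 0 ≤ f l Q := fun l => (hf0 l 1).trans (hfQ l 1)
  have hsumm : Summable fun l => f l Q := summable_sTerm α hQ.1 hQ.2
  have hsum : ∑' l, f l Q = sSeries α Q := rfl
  set l₀ := squareIndex j with hl₀
  have hl₀2 : 2 * l₀ + 1 = (2 * j + 1) ^ 2 := two_mul_squareIndex j
  have hj1 : 1 ≤ j := Nat.one_le_iff_ne_zero.2 hj0
  have hjl : j < l₀ := by rw [hl₀, squareIndex]; nlinarith
  have hsq : ∀ n, f l₀ (q n) ≤ f j (q n) ^ 2 := fun n => by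
    have h1 := sTerm_squareIndex_le (hq n).1 (hq n).2 j
    have h2 : (2 * (l₀ : ℝ) + 1) ^ α = ((2 * (j : ℝ) + 1) ^ α) ^ 2 := by
      have h3 : (2 * (l₀ : ℝ) + 1) = (2 * (j : ℝ) + 1) ^ 2 := by exact_mod_cast hl₀2
      rw [h3, ← Real.rpow_natCast, ← Real.rpow_mul (by positivity), ← Real.rpow_natCast,
        ← Real.rpow_mul (by positivity), mul_comm α]
    simp only [hf]
    rw [h2, mul_pow]
    gcongr
  set a := f j Q with ha
  set c := f l₀ Q with hc
  have hf00 : ∀ {x : ℝ}, x < 1 → f 0 x = 1 := fun hx => by simp [hf, sTerm_zero_left hx]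
  -- `1 + a + c ≤ s_α(Q) < 2 + c / 2`
  have ha1 : a < 1 := by
    have h := hsumm.sum_le_tsum {0, j, l₀} fun l _ => hfQ0 l
    rw [Finset.sum_insert (by simp; omega), Finset.sum_pair hjl.ne, hf00 hQ.2, hsum] at h
    have := hfQ0 l₀
    linarith
  have hW : ∀ l, ‖weightedDilation 𝕜 (oddPNat l) (hfabs l)‖ ≤ f l Q := fun l =>
    norm_weightedDilation_le _ _
  have hWs : Summable fun l => weightedDilation 𝕜 (oddPNat l) (hfabs l) :=
    Summable.of_norm_bounded hsumm hW
  refine ⟨∑' l, weightedDilation 𝕜 (oddPNat l) (hfabs l), ?_, fun n m => ?_⟩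
  · have hhalf : ∀ n, |f j (q n) / 2| ≤ a / 2 := fun n => by
      rw [abs_of_nonneg (by linarith [hf0 j n])]
      linarith [hfQ j n]
    -- for the upper bound, one half of `f l₀` is estimated by `c / 2`, the other by `f j ^ 2 / 2`
    have hdiff : ∀ n, |f l₀ (q n) - f j (q n) ^ 2 / 4| ≤ c / 2 + a ^ 2 / 4 := fun n => by
      have h1 := hsq n
      have h2 := hfQ l₀ n
      have h3 := hf0 l₀ n
      have h4 : f j (q n) ^ 2 ≤ a ^ 2 := pow_le_pow_left₀ (hf0 j n) (hfQ j n) 2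
      rw [abs_le]
      constructor <;> linarith
    set B := weightedDilation 𝕜 p hhalf with hB
    refine isUnit_of_norm_sub_sq_lt (b := B) (β := a / 2) ContinuousLinearMap.norm_id_le
      (norm_weightedDilation_le _ _) (by linarith) ?_
    have hpj : p = oddPNat j := PNat.coe_injective hj
    have hpl : oddPNat l₀ = p * p := PNat.coe_injective (by
      rw [coe_oddPNat, hl₀2, PNat.mul_coe, hj, sq])
    have h0 : weightedDilation 𝕜 (oddPNat 0) (hfabs 0) = 1 := by
      refine clm_ext_single fun n => ?_
      have : oddPNat 0 * n = n := one_mul n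
      rw [weightedDilation_single, hf00 (hq n).2, this]
      simp
    have h1 : weightedDilation 𝕜 (oddPNat j) (hfabs j) = 2 * B := by
      refine clm_ext_single fun n => ?_
      rw [two_mul, add_apply, hB, weightedDilation_single,
        weightedDilation_single, ← lp.single_add, hpj, ← add_mul, ← RCLike.ofReal_add, add_halves]
    have h2 : weightedDilation 𝕜 (oddPNat l₀) (hfabs l₀) - B ^ 2 =
        weightedDilation 𝕜 (p * p) hdiff := by
      refine clm_ext_single fun n => ?_
      rw [sq, sub_apply, mul_apply_eq_comp, hB,
        weightedDilation_single, weightedDilation_single, weightedDilation_single,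
        weightedDilation_single, hpl, ← mul_assoc, ← lp.single_sub, ← hqp]
      congr 1
      push_cast
      ring
    -- the terms of the series which belong to `(1 + B)²`, and the size of what remains
    set Z : ℕ → lp (fun _ : ℕ+ => 𝕜) 2 →L[𝕜] lp (fun _ : ℕ+ => 𝕜) 2 := fun l =>
      (if l = 0 then 1 else 0) + (if l = j then 2 * B else 0) + (if l = l₀ then B ^ 2 else 0)
      with hZ
    have hZs : HasSum Z (1 + 2 * B + B ^ 2) :=
      ((hasSum_ite_eq 0 _).add (hasSum_ite_eq j _)).add (hasSum_ite_eq l₀ _)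
    set t : ℕ → ℝ := fun l => f l Q - ((if l = 0 then 1 else 0) + (if l = j then a else 0) +
      (if l = l₀ then c / 2 - a ^ 2 / 4 else 0)) with ht
    have hts : HasSum t (sSeries α Q - (1 + a + (c / 2 - a ^ 2 / 4))) :=
      hsumm.hasSum.sub (((hasSum_ite_eq 0 _).add (hasSum_ite_eq j _)).add (hasSum_ite_eq l₀ _))
    have hbound : ∀ l, ‖weightedDilation 𝕜 (oddPNat l) (hfabs l) - Z l‖ ≤ t l := fun l => by
      rcases eq_or_ne l 0 with rfl | hl0
      · have hl : (0 : ℕ) ≠ l₀ := by omega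
        simp only [hZ, ht, if_neg hl, if_neg hj0.symm, if_true]
        rw [h0, hf00 hQ.2]
        simp
      rcases eq_or_ne l j with rfl | hlj
      · simp [hZ, ht, h1, hl0, hjl.ne, ha]
      rcases eq_or_ne l l₀ with rfl | hll
      · have h3 := norm_weightedDilation_le (𝕜 := 𝕜) (p * p) hdiff
        simp only [hZ, ht, if_neg hl0, if_neg hlj, if_true, zero_add]
        rw [h2]
        refine h3.trans (le_of_eq ?_)
        rw [hc]
        ring
      · simpa [hZ, ht, hl0, hlj, hll] using hW l
    have hX : ‖∑' l, weightedDilation 𝕜 (oddPNat l) (hfabs l) - (1 + B) ^ 2‖ ≤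
        sSeries α Q - (1 + a + (c / 2 - a ^ 2 / 4)) := by
      have h3 := tsum_of_norm_bounded hts hbound
      rw [hWs.tsum_sub hZs.summable, hZs.tsum_eq] at h3
      rwa [show (1 + B) ^ 2 = 1 + 2 * B + B ^ 2 by noncomm_ring]
    refine hX.trans_lt ?_
    rw [show (1 - a / 2) ^ 2 = 1 - a + a ^ 2 / 4 by ring]
    have hs' : sSeries α Q < 2 + c / 2 := hs
    linarith
  · have h1 := ((ContinuousLinearMap.apply 𝕜 _
      (lp.single (E := fun _ : ℕ+ => 𝕜) 2 n 1)).hasSum hWs.hasSum).mapL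
        (lp.evalCLM 𝕜 (fun _ : ℕ+ => 𝕜) 2 m)
    have h2 : ∀ l, (lp.evalCLM 𝕜 (fun _ : ℕ+ => 𝕜) 2 m) ((ContinuousLinearMap.apply 𝕜 _
        (lp.single (E := fun _ : ℕ+ => 𝕜) 2 n 1)) (weightedDilation 𝕜 (oddPNat l) (hfabs l))) =
        ((if oddPNat l * n = m then f l (q n) else 0 : ℝ) : 𝕜) := fun l => by
      rw [ContinuousLinearMap.apply_apply, weightedDilation_single]
      change lp.single (E := fun _ : ℕ+ => 𝕜) 2 (oddPNat l * n) _ m = _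
      rw [lp.single_apply, Pi.single_apply, mul_one]
      by_cases h : oddPNat l * n = m
      · simp [h]
      · simp [h, Ne.symm h]
    simp only [h2] at h1
    rw [RCLike.ofReal_tsum]
    exact h1.tsum_eq.symm

end Dilation

/-! ### The basis property -/

/-- An invertible operator from `ℓ²` maps the unit vectors, up to non-zero factors `w n`, to an
unconditional Schauder basis. -/
noncomputable def schauderBasisOfEquiv {𝕜 X : Type*} [RCLike 𝕜] [NormedAddCommGroup X]
    [NormedSpace 𝕜 X] (e : lp (fun _ : ℕ+ => 𝕜) 2 ≃L[𝕜] X) (w : ℕ+ → 𝕜) (hw : ∀ n, w n ≠ 0) :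
    UnconditionalSchauderBasis ℕ+ 𝕜 X where
  basis n := w n • e (lp.single (E := fun _ : ℕ+ => 𝕜) 2 n 1)
  coord n := (w n)⁻¹ • (lp.evalCLM 𝕜 (fun _ : ℕ+ => 𝕜) 2 n ∘L (e.symm : X →L[𝕜] _))
  ortho i j := by
    have h : ((w i)⁻¹ • (lp.evalCLM 𝕜 (fun _ : ℕ+ => 𝕜) 2 i ∘L (e.symm : X →L[𝕜] _)))
        (w j • e (lp.single (E := fun _ : ℕ+ => 𝕜) 2 j 1)) =
        (w i)⁻¹ * (w j * (lp.single (E := fun _ : ℕ+ => 𝕜) 2 j (1 : 𝕜)) i) := by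
      rw [map_smul, smul_eq_mul, mul_left_comm]
      simp [lp.evalCLM]
    rw [h]
    rcases eq_or_ne i j with rfl | hij
    · simp [Pi.single, hw i]
    · rw [lp.single_apply_ne _ _ _ hij]
      simp [Pi.single, hij]
  expansion x := by
    have h := (lp.hasSum_single (by norm_num) (e.symm x)).mapL (e : _ →L[𝕜] X)
    simp only [ContinuousLinearEquiv.coe_coe, ContinuousLinearEquiv.apply_symm_apply] at h
    refine (congrArg (fun g => HasSum g x) (funext fun i => ?_)).mp h
    have h1 : lp.single (E := fun _ : ℕ+ => 𝕜) 2 i (e.symm x i) =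
        e.symm x i • lp.single (E := fun _ : ℕ+ => 𝕜) 2 i (1 : 𝕜) := by
      rw [← lp.single_smul, smul_eq_mul, mul_one]
    rw [h1, map_smul, smul_smul]
    congr 1
    change _ = (w i)⁻¹ * e.symm x i * w i
    rw [mul_right_comm, inv_mul_cancel₀ (hw i), one_mul]

theorem isSobolevBasis_gpFun {𝕜 : Type*} [RCLike 𝕜] {p : ℕ+} (hp : p ≠ 1) (hodd : Odd (p : ℕ))
    {α : ℝ} (hα : 0 ≤ α) {r : ℝ} (hr : IsThreshold p α r) {q : ℕ+ → ℝ}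
    (hq : ∀ n, q n ∈ Ioo (0 : ℝ) 1) (hqr : (⨆ n, q n) < r) (hqp : ∀ n, q n = q (p * n))
    {μ : ℕ+ → ℝ} (hμ : ∀ n, μ n ∈ Ioo (0 : ℝ) 1) (hnome : ∀ n, nome (μ n) = q n) :
    IsSobolevBasis 𝕜 α (fun n x => ((gpFun n (μ n) x : ℝ) : 𝕜)) := by
  obtain ⟨j, hj⟩ := hodd
  have hj0 : j ≠ 0 := fun h => hp (PNat.coe_injective (by rw [hj, h]; rfl))
  have hbdd : BddAbove (range q) := ⟨1, by rintro _ ⟨n, rfl⟩; exact (hq n).2.le⟩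
  set Q := ⨆ n, q n with hQ
  have hqQ : ∀ n, q n ≤ Q := fun n => le_ciSup hbdd n
  have hQ0 : 0 < Q := (hq 1).1.trans_le (hqQ 1)
  obtain ⟨A, ⟨U, hU⟩, hA⟩ := exists_isUnit_dilationSeries (𝕜 := 𝕜) hj hj0
    ⟨hQ0, hqr.trans hr.1.2⟩ (sSeries_lt_of_lt_threshold hj hα hr hQ0 hqr) hq hqQ hqp
  set e := (ContinuousLinearEquiv.ofUnit U).trans
    (sobolevEquiv 𝕜 hα).symm.toContinuousLinearEquiv with he
  have hw : ∀ n : ℕ+, 4 * Real.pi * (n : ℕ) * ((n : ℕ) : ℝ) ^ α *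
      (Real.sqrt (q n) / (1 - q n)) ≠ 0 := fun n => by
    have h1 : (0 : ℝ) < (n : ℕ) := Nat.cast_pos.2 n.pos
    have h2 := Real.sqrt_pos.2 (hq n).1
    have h3 : 0 < 1 - q n := by linarith [(hq n).2]
    have h4 := Real.pi_pos
    positivity
  refine ⟨schauderBasisOfEquiv e (fun n => ((4 * Real.pi * (n : ℕ) * ((n : ℕ) : ℝ) ^ α *
    (Real.sqrt (q n) / (1 - q n)) : ℝ) : 𝕜)) (fun n => RCLike.ofReal_ne_zero.2 (hw n)),
    fun n => ?_⟩
  refine ae_eq_of_sineCoeff_eq (Lp.memLp _)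
    (RCLike.continuous_ofReal.comp (continuous_gpFun n (hμ n))).memLp_unitMeasure fun m => ?_
  have hm : (0 : ℝ) < (m : ℕ) := Nat.cast_pos.2 m.pos
  refine smul_right_injective 𝕜 (Real.rpow_pos_of_pos hm α).ne' ?_
  beta_reduce
  rw [← sobolevEquiv_apply 𝕜 hα]
  have hleft : sobolevEquiv 𝕜 hα (schauderBasisOfEquiv e (fun n => ((4 * Real.pi * (n : ℕ) *
      ((n : ℕ) : ℝ) ^ α * (Real.sqrt (q n) / (1 - q n)) : ℝ) : 𝕜))
        (fun n => RCLike.ofReal_ne_zero.2 (hw n)) n) m =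
      ((4 * Real.pi * (n : ℕ) * ((n : ℕ) : ℝ) ^ α * (Real.sqrt (q n) / (1 - q n)) : ℝ) : 𝕜) *
        A (lp.single (E := fun _ : ℕ+ => 𝕜) 2 n 1) m := by
    rw [← hU]
    change sobolevEquiv 𝕜 hα (_ • (sobolevEquiv 𝕜 hα).symm
      ((U : lp (fun _ : ℕ+ => 𝕜) 2 →L[𝕜] lp (fun _ : ℕ+ => 𝕜) 2)
        (lp.single (E := fun _ : ℕ+ => 𝕜) 2 n 1))) m = _
    rw [map_smul, LinearIsometryEquiv.apply_symm_apply, lp.coeFn_smul, Pi.smul_apply, smul_eq_mul]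
  rw [hleft, hA, sineCoeff_gpFun n (hμ n), hnome, RCLike.real_smul_eq_coe_mul, ← RCLike.ofReal_mul,
    ← RCLike.ofReal_mul, ← tsum_mul_left, ← tsum_mul_left, ← tsum_mul_left]
  congr 1
  refine tsum_congr fun l => ?_
  split_ifs with h
  · have hmn : ((m : ℕ) : ℝ) = (2 * (l : ℝ) + 1) * (n : ℕ) := by
      rw [← h, PNat.mul_coe, coe_oddPNat]; push_cast; ring
    have h3 : 1 - q n ≠ 0 := by linarith [(hq n).2]
    rw [hmn, Real.mul_rpow (by positivity) (by positivity), sTerm, pow_succ (Real.sqrt (q n)),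
      pow_mul, Real.sq_sqrt (hq n).1.le]
    field_simp
  · simp

theorem theorem4p2 {𝕜 : Type*} [RCLike 𝕜] (p : ℕ+) (hp : p ≠ 1) (hodd : Odd (p : ℕ))
    (α : ℝ) (hα : 0 ≤ α) :
    (∃! r : ℝ, IsThreshold p α r) ∧
    ∀ r : ℝ, IsThreshold p α r →
      ∀ q : ℕ+ → ℝ, (∀ n, q n ∈ Ioo (0 : ℝ) 1) → (⨆ n, q n) < r → (∀ n, q n = q (p * n)) →
        ∀ μ : ℕ+ → ℝ, (∀ n, μ n ∈ Ioo (0 : ℝ) 1) → (∀ n, nome (μ n) = q n) →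
          (∀ n, IsGPEigenfunction (gpFun n (μ n)) (gpEigenvalue n (μ n))) ∧
          IsSobolevBasis 𝕜 α (fun n x => ((gpFun n (μ n) x : ℝ) : 𝕜)) := by
  refine ⟨?_, fun r hr q hq hqr hqp μ hμ hnome => ⟨fun n => isGPEigenfunction_gpFun n (hμ n),
    isSobolevBasis_gpFun hp hodd hα hr hq hqr hqp hμ hnome⟩⟩
  obtain ⟨j, hj⟩ := hodd
  exact existsUnique_isThreshold hj (fun h => hp (PNat.coe_injective (by rw [hj, h]; rfl))) hα
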